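/- **Setting.** All graphs are finite, simple, undirected and connected. For a graph $G$ let $B(G)$ be the set of pairs $(v,e)$ with $v$ an endpoint of the edge $e$. An *input-labeled graph* is a graph $G$ with a map $B(G)\to\Sigma$ into a label set $\Sigma$. For $t\ge 0$, the neighborhood $N^t(v)$ of a node $v$ is the information $v$ can obtain in $t$ rounds: the subgraph induced by the nodes at distance at most $t$ from $v$, together with the initial information of each of these nodes $a$ (all its incident edges, including those that leave the neighborhood, and the input labels of all pairs $(a,e)$). For an edge $e=\{u,v\}$, $N^t(e)$ is defined in the same way from the set of nodes at distance at most $t$ from both $u$ and $v$. Put $\mathrm{ext}^t_v(e)=N^t(v)\setminus N^t(e)$ and $\mathrm{ext}^t_e(v)=N^t(e)\setminus N^{t-1}(v)$; $\cong$ denotes isomorphism of such information. Let $t\ge 1$. A class $\mathcal G_{n,\Delta}$ of input-labeled graphs with $n$ nodes and maximum degree $\Delta$ is *$t$-independent* if for every $G\in\mathcal G_{n,\Delta}$: 1. for every edge $e=\{u,v\}$ of $G$: if $X$ is an extension $\mathrm{ext}^t_{v_1}(e_1)$ occurring in some $H_1\in\mathcal G_{n,\Delta}$ with $N^t_{H_1}(e_1)\cong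 N^t_G(e)$ ($v_1$ corresponding to $v$), and $X'$ is an extension $\mathrm{ext}^t_{u_2}(e_2)$ occurring in some $H_2\in\mathcal G_{n,\Delta}$ with $N^t_{H_2}(e_2)\cong N^t_G(e)$ ($u_2$ corresponding to $u$), then there are $H\in\mathcal G_{n,\Delta}$ and an edge $e'=\{x,w\}$ of $H$ with $N^t_H(e')\cong N^t_G(e)$ ($w$ corresponding to $v$ and $x$ to $u$), $\mathrm{ext}^t_{w}(e')\cong X$ and $\mathrm{ext}^t_{x}(e')\cong X'$; 2. for every node $v$ of $G$: if for each edge $e'$ incident to $v$, $X_{e'}$ is an extension occurring in some $H_{e'}\in\mathcal G_{n,\Delta}$ as $\mathrm{ext}^t_{e''}(w')$, where $N^{t-1}_{H_{e'}}(w')\cong N^{t-1}_G(v)$ and $e''$ corresponds to $e'$, then there are $H\in\mathcal G_{n,\Delta}$ and a node $w$ of $H$ with $N^{t-1}_H(w)\cong N^{t-1}_G(v)$ such that, for all $e'$ incident to $v$, $\mathrm{ext}^t_{e''}(w)\cong X_{e'}$ for the edge $e''$ of $H$ corresponding to $e'$. (All these isomorphisms of extensions are compatible with the given identifications of the neighborhoods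 being extended.) **Problems.** A problem $\Pi$ consists of a set $\mathcal O$ of output labels and, for every $\Delta\in\mathbb N$, a finite set $f(\Delta)\subseteq\mathcal O$, a set $g(\Delta)$ of $2$-element multisets over $f(\Delta)$ and a set $h(\Delta)$ of multisets over $f(\Delta)$ with at most $\Delta$ elements. A solution on a graph of maximum degree $\Delta$ assigns $o_{v,e}\in f(\Delta)$ to each $(v,e)\in B(G)$ such that $\{o_{u,e},o_{v,e}\}\in g(\Delta)$ for every edge $e=\{u,v\}$ and $\{o_{v,e_1},\dots,o_{v,e_{d(v)}}\}\in h(\Delta)$ for every node $v$ with incident edges $e_1,\dots,e_{d(v)}$. *Derived problems.* $\Pi_{1/2}$ has label set $2^{\mathcal O}$ and $f_{1/2}(\Delta)=2^{f(\Delta)}$; $g_{1/2}(\Delta)$ is the set of all $\{Y,Z\}$ with $Y,Z\in f_{1/2}(\Delta)$ such that $\{y,z\}\in g(\Delta)$ for all $y\in Y$, $z\in Z$; $h_{1/2}(\Delta)$ is the set of all $\{Y_1,\dots,Y_i\}$ with $i\le\Delta$ and $Y_j\in f_{1/2}(\Delta)$ such that $\{y_1,\dots,y_i\}\in h(\Delta)$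 for some $y_1\in Y_1,\dots,y_i\in Y_i$. $\Pi_1$ has label set $2^{2^{\mathcal O}}$ and $f_1(\Delta)=2^{f_{1/2}(\Delta)}$; $g_1(\Delta)$ is the set of all $\{Y,Z\}$ with $Y,Z\in f_1(\Delta)$ such that $\{y,z\}\in g_{1/2}(\Delta)$ for some $y\in Y$, $z\in Z$; $h_1(\Delta)$ is the set of all $\{Y_1,\dots,Y_i\}$ with $i\le\Delta$ and $Y_j\in f_1(\Delta)$ such that $\{y_1,\dots,y_i\}\in h_{1/2}(\Delta)$ for all $y_1\in Y_1,\dots,y_i\in Y_i$. *Simplified problems.* $g'_{1/2}(\Delta)$ consists of those $\{Y,Z\}\in g_{1/2}(\Delta)$ for which replacing one of $Y,Z$ by any proper superset in $f_{1/2}(\Delta)$ gives a multiset not in $g_{1/2}(\Delta)$. $\Pi'_1$ is obtained from $\Pi_1$ by replacing $g_{1/2}$ by $g'_{1/2}$ in the definition of $g_1$, and by keeping in $h_1(\Delta)$ only those $\{Y_1,\dots,Y_i\}$ for which replacing one $Y_j$ by any proper superset in $f_1(\Delta)$ gives a multiset not in $h_1(\Delta)$. **Algorithms.** We work in the deterministic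 port numbering model: the edges incident to each node $v$ are numbered $1,\dots,d(v)$, and all nodes know $n$ and $\Delta$. On a class of graphs whose nodes also carry unique identifiers, a $t$-round algorithm is a function that maps each radius-$t$ neighborhood of a node $v$ (including input labels, port numbers and identifiers) to an output for each pair $(v,e)$. It solves $\Pi$ on the class if its output is a solution for every graph of the class and every port numbering. It is *order-invariant* if the output of a node does not change when the identifiers in its radius-$t$ neighborhood are replaced by others in the same relative order. **Theorem.** Let $\Pi$ be a problem with derived problems $\Pi_1$ and $\Pi'_1$, let $t\ge1$, and let $\mathcal G_{n,\Delta}$ be a class of input-labeled graphs with $n$ nodes and maximum degree $\Delta$ that is $t$-independent and contains only graphs of girth at least $2t+2$ (acyclic graphs have infinite girth). Let $S\subseteq\mathbb N^+$ be a finite set with $|S|\ge 4\Delta^{2t}$, and let $\mathcal G'_{n,\Delta}$ be the class of all graphs obtained by taking a graph from $\mathcal G_{n,\Delta}$ and assigning unique identifiers from $S$ to its nodes. Then the following are equivalent: 1. there is an order-invariant algorithm solving $\Pi$ on $\mathcal G'_{n,\Delta}$ in $t$ rounds; 2. there is an order-invariant algorithm solving $\Pi_1$ on $\mathcal G'_{n,\Delta}$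 in $t-1$ rounds; 3. there is an order-invariant algorithm solving $\Pi'_1$ on $\mathcal G'_{n,\Delta}$ in $t-1$ rounds. -/

import Mathlib

namespace LocalSpeedup

/-! ### Problems and derived problems -/

/-- A (node-and-edge-checkable) problem with output labels in `O`. For every maximum degree `Δ`:
a finite set `f Δ` of usable labels, a set `g Δ` of 2-element multisets over `f Δ` (allowed edge
configurations) and a set `h Δ` of multisets over `f Δ` with at most `Δ` elements (allowed node
configurations). -/
structure Problem (O : Type*) where
  f : ℕ → Set O
  g : ℕ → Set (Sym2 O)
  h : ℕ → Set (Multiset O)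
  f_finite : ∀ Δ, (f Δ).Finite
  g_mem : ∀ Δ, ∀ s ∈ g Δ, ∀ y ∈ s, y ∈ f Δ
  h_card : ∀ Δ, ∀ M ∈ h Δ, Multiset.card M ≤ Δ
  h_mem : ∀ Δ, ∀ M ∈ h Δ, ∀ y ∈ M, y ∈ f Δ

namespace Problem

variable {O : Type*}

/-- Every choice of `y ∈ Y` and `z ∈ Z` gives an allowed edge configuration of `P`. -/
def EdgeForall (P : Problem O) (Δ : ℕ) (Y Z : Set O) : Prop :=
  ∀ y ∈ Y, ∀ z ∈ Z, s(y, z) ∈ P.g Δ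

/-- Some choice of `y ∈ Y` and `z ∈ Z` gives an allowed edge configuration of `P`. -/
def EdgeExists (P : Problem O) (Δ : ℕ) (Y Z : Set O) : Prop :=
  ∃ y ∈ Y, ∃ z ∈ Z, s(y, z) ∈ P.g Δ

/-- Every choice of one element from each member of the multiset `M = {Y₁, …, Yᵢ}` gives an
allowed node configuration `N = {y₁, …, yᵢ}` of `P`. -/
def NodeForall (P : Problem O) (Δ : ℕ) (M : Multiset (Set O)) : Prop :=
  ∀ N : Multiset O, Multiset.Rel (fun y Y => y ∈ Y) N M → N ∈ P.h Δ

/-- Some choice of one element from each member of the multiset `M = {Y₁, …, Yᵢ}` gives an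
allowed node configuration `N = {y₁, …, yᵢ}` of `P`. -/
def NodeExists (P : Problem O) (Δ : ℕ) (M : Multiset (Set O)) : Prop :=
  ∃ N : Multiset O, Multiset.Rel (fun y Y => y ∈ Y) N M ∧ N ∈ P.h Δ

/-- The edge configuration `{Y, Z}` satisfies `EdgeForall`, and neither of the two sets can be
replaced by a proper superset (within the usable labels `2 ^ f Δ`) without violating it. -/
def EdgeMaximal (P : Problem O) (Δ : ℕ) (Y Z : Set O) : Prop :=
  P.EdgeForall Δ Y Z ∧
    (∀ Y' ⊆ P.f Δ, Y ⊂ Y' → ¬ P.EdgeForall Δ Y' Z) ∧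
    (∀ Z' ⊆ P.f Δ, Z ⊂ Z' → ¬ P.EdgeForall Δ Y Z')

/-- The node configuration `M` satisfies `NodeForall`, and no single member `Y` of `M` can be
replaced by a proper superset (within the usable labels `2 ^ f Δ`) without violating it. -/
def NodeMaximal (P : Problem O) (Δ : ℕ) (M : Multiset (Set O)) : Prop :=
  P.NodeForall Δ M ∧
    ∀ (Y : Set O) (R : Multiset (Set O)), M = Y ::ₘ R →
      ∀ Y' ⊆ P.f Δ, Y ⊂ Y' → ¬ P.NodeForall Δ (Y' ::ₘ R)

/-- The problem over the label set `2 ^ O` with usable labels `2 ^ f Δ`, whose edge configurations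
are cut out by the predicate `E` and whose node configurations are cut out by `N`. -/
def powerProblem (P : Problem O) (E : ℕ → Set O → Set O → Prop)
    (N : ℕ → Multiset (Set O) → Prop) : Problem (Set O) where
  f Δ := 𝒫 (P.f Δ)
  g Δ := {s | ∃ Y Z : Set O, s = s(Y, Z) ∧ Y ⊆ P.f Δ ∧ Z ⊆ P.f Δ ∧ E Δ Y Z}
  h Δ := {M | Multiset.card M ≤ Δ ∧ (∀ Y ∈ M, Y ⊆ P.f Δ) ∧ N Δ M}
  f_finite Δ := (P.f_finite Δ).powerset
  g_mem := by
    rintro Δ s ⟨Y, Z, rfl, hY, hZ, -⟩ W hW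
    rcases Sym2.mem_iff.1 hW with rfl | rfl
    · exact hY
    · exact hZ
  h_card := fun _ _ hM => hM.1
  h_mem := fun _ _ hM => hM.2.1

/-- The derived problem `Π_{1/2}`. -/
def half (P : Problem O) : Problem (Set O) := P.powerProblem P.EdgeForall P.NodeExists

/-- The step leading from `Π_{1/2}` to `Π_1` (with the quantifiers of `half` exchanged). -/
def dualHalf (P : Problem O) : Problem (Set O) := P.powerProblem P.EdgeExists P.NodeForall

/-- The derived problem `Π_1`. -/
def one (P : Problem O) : Problem (Set (Set O)) := P.half.dualHalf

/-- The simplified problem `Π'_{1/2}`. -/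
def half' (P : Problem O) : Problem (Set O) := P.powerProblem P.EdgeMaximal P.NodeExists

/-- The simplified version of the step `dualHalf`. -/
def dualHalf' (P : Problem O) : Problem (Set O) := P.powerProblem P.EdgeExists P.NodeMaximal

/-- The simplified problem `Π'_1`. As `half` and `half'` differ only in `g`, this is `Π_1` with
`h_1` restricted to maximal configurations and with `g_{1/2}` replaced by `g'_{1/2}`. -/
def one' (P : Problem O) : Problem (Set (Set O)) := P.half'.dualHalf'

end Problem

/-! ### Input-labeled graphs and neighborhoods -/

/-- A (simple, undirected, connected) input-labeled graph with node set `Fin n`.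
`label v u _` is the input label of the pair `(v, e)` with `e = {v, u}`. -/
structure LabeledGraph (Λ : Type*) (n : ℕ) where
  graph : SimpleGraph (Fin n)
  connected : graph.Connected
  label : ∀ v u : Fin n, graph.Adj v u → Λ

variable {Λ : Type*} {n : ℕ}

open Classical in
/-- The maximum degree of an input-labeled graph. -/
noncomputable def LabeledGraph.maxDegree (G : LabeledGraph Λ n) : ℕ := G.graph.maxDegree

/-- The nodes of the radius-`t` neighborhood `N^t(v)`. -/
def LabeledGraph.ball (G : LabeledGraph Λ n) (t : ℕ) (v : Fin n) : Set (Fin n) :=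
  {w | G.graph.dist v w ≤ t}

/-- The nodes of the radius-`t` neighborhood `N^t(e)` of the edge `e = {u, v}`. -/
def LabeledGraph.edgeBall (G : LabeledGraph Λ n) (t : ℕ) (u v : Fin n) : Set (Fin n) :=
  G.ball t u ∩ G.ball t v

/-- `σ`, `τ` form an isomorphism from the information contained in the node set `A` of `G` to the
information contained in the node set `B` of `H`. The information consists of the induced
subgraph together with everything the nodes know at the beginning, i.e. for every node `a ∈ A` all
its incident edges (also those that leave `A`) and the input labels of all pairs `(a, e)`.
`σ` maps nodes to nodes, and `τ a` maps the edges incident to `a` (given by their other endpoints)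
to the edges incident to `σ a`. -/
structure IsInfoIso (G : LabeledGraph Λ n) (A : Set (Fin n)) (H : LabeledGraph Λ n)
    (B : Set (Fin n)) (σ : Fin n → Fin n) (τ : Fin n → Fin n → Fin n) : Prop where
  nodes : Set.BijOn σ A B
  edges : ∀ a ∈ A, Set.BijOn (τ a) (G.graph.neighborSet a) (H.graph.neighborSet (σ a))
  /-- An edge inside `A` is mapped to the edge between the images of its endpoints. -/
  inner : ∀ a ∈ A, ∀ b ∈ A, G.graph.Adj a b → τ a b = σ b
  /-- An edge leaving `A` is mapped to an edge leaving `B`. -/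
  outer : ∀ a ∈ A, ∀ b, b ∉ A → G.graph.Adj a b → τ a b ∉ B
  label_eq : ∀ a ∈ A, ∀ (b : Fin n) (h : G.graph.Adj a b) (h' : H.graph.Adj (σ a) (τ a b)),
    H.label (σ a) (τ a b) h' = G.label a b h

/-- The isomorphism `ρ, κ` is compatible on `A` with `σ₁, τ₁` and `σ, τ`: following `σ₁, τ₁` by
`ρ, κ` gives `σ, τ` on all nodes of `A` and all edges incident to them. -/
def Extends (G : LabeledGraph Λ n) (A : Set (Fin n))
    (σ₁ : Fin n → Fin n) (τ₁ : Fin n → Fin n → Fin n)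
    (ρ : Fin n → Fin n) (κ : Fin n → Fin n → Fin n)
    (σ : Fin n → Fin n) (τ : Fin n → Fin n → Fin n) : Prop :=
  ∀ a ∈ A, ρ (σ₁ a) = σ a ∧ ∀ b, G.graph.Adj a b → κ (σ₁ a) (τ₁ a b) = τ a b

/-- First half of `t`-independence: the extensions of `N^t(e)` along the two endpoints of
`e = {u, v}` are independent. An element of `extra^t_v(e)` is given by a graph `H₁` of the class
and an isomorphism `σ₁, τ₁` from `N^t(e)` to the neighborhood of an edge `{u₁, v₁}` of `H₁`, and
similarly `H₂` and `σ₂, τ₂` for `u`. Since `N^t(e) ∪ ext^t_v(e) = N^t(v)`, that the extension of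
`{x, w}` along `w` in `H` is the one given by `H₁` is expressed by an isomorphism from `N^t(v₁)` to
`N^t(w)` that is compatible with the identifications of `N^t(e)`. -/
def EdgeIndependent (𝒢 : Set (LabeledGraph Λ n)) (t : ℕ) : Prop :=
  ∀ G ∈ 𝒢, ∀ u v : Fin n, G.graph.Adj u v →
    ∀ H₁ ∈ 𝒢, ∀ u₁ v₁ : Fin n, H₁.graph.Adj u₁ v₁ → ∀ σ₁ τ₁,
      IsInfoIso G (G.edgeBall t u v) H₁ (H₁.edgeBall t u₁ v₁) σ₁ τ₁ → σ₁ u = u₁ → σ₁ v = v₁ →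
    ∀ H₂ ∈ 𝒢, ∀ u₂ v₂ : Fin n, H₂.graph.Adj u₂ v₂ → ∀ σ₂ τ₂,
      IsInfoIso G (G.edgeBall t u v) H₂ (H₂.edgeBall t u₂ v₂) σ₂ τ₂ → σ₂ u = u₂ → σ₂ v = v₂ →
    ∃ H ∈ 𝒢, ∃ x w : Fin n, H.graph.Adj x w ∧ ∃ σ τ,
      IsInfoIso G (G.edgeBall t u v) H (H.edgeBall t x w) σ τ ∧ σ u = x ∧ σ v = w ∧
      (∃ ρ κ, IsInfoIso H₁ (H₁.ball t v₁) H (H.ball t w) ρ κ ∧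
        Extends G (G.edgeBall t u v) σ₁ τ₁ ρ κ σ τ) ∧
      (∃ ρ κ, IsInfoIso H₂ (H₂.ball t u₂) H (H.ball t x) ρ κ ∧
        Extends G (G.edgeBall t u v) σ₂ τ₂ ρ κ σ τ)

/-- Second half of `t`-independence: the extensions of `N^{t-1}(v)` along the edges incident to
`v` are independent. For each edge `e' = {v, u}`, an element of `extra^t_{e'}(v)` is given by a
graph `K u` of the class, a node `c u` and an isomorphism `σ' u, τ' u` from `N^{t-1}(v)` to
`N^{t-1}(c u)`, under which `e'` corresponds to the edge `{c u, τ' u v u}`. Note that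
`N^{t-1}(v) ∪ ext^t_{e'}(v) = N^t(e')`. -/
def NodeIndependent (𝒢 : Set (LabeledGraph Λ n)) (t : ℕ) : Prop :=
  ∀ G ∈ 𝒢, ∀ v : Fin n,
    ∀ (K : Fin n → LabeledGraph Λ n) (c : Fin n → Fin n) (σ' : Fin n → Fin n → Fin n)
      (τ' : Fin n → Fin n → Fin n → Fin n),
      (∀ u, G.graph.Adj v u → K u ∈ 𝒢 ∧
        IsInfoIso G (G.ball (t - 1) v) (K u) ((K u).ball (t - 1) (c u)) (σ' u) (τ' u) ∧
        σ' u v = c u) →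
    ∃ H ∈ 𝒢, ∃ w : Fin n, ∃ σ τ,
      IsInfoIso G (G.ball (t - 1) v) H (H.ball (t - 1) w) σ τ ∧ σ v = w ∧
      ∀ u, G.graph.Adj v u → ∃ ρ κ,
        IsInfoIso (K u) ((K u).edgeBall t (c u) (τ' u v u)) H (H.edgeBall t w (τ v u)) ρ κ ∧
        Extends G (G.ball (t - 1) v) (σ' u) (τ' u) ρ κ σ τ

/-- `t`-independence (for positive `t`) of a class of input-labeled graphs with `n` nodes. -/
def TIndependent (𝒢 : Set (LabeledGraph Λ n)) (t : ℕ) : Prop :=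
  EdgeIndependent 𝒢 t ∧ NodeIndependent 𝒢 t

/-! ### Identifiers, port numbers and algorithms -/

/-- The class of all graphs obtained by taking a graph from `𝒢` and assigning unique identifiers
from `S` to its nodes. -/
def withIds (𝒢 : Set (LabeledGraph Λ n)) (S : Finset ℕ+) :
    Set (LabeledGraph Λ n × (Fin n → ℕ+)) :=
  {x | x.1 ∈ 𝒢 ∧ Function.Injective x.2 ∧ ∀ v, x.2 v ∈ S}

/-- A port numbering: the edges incident to a node `v` are numbered by `0, …, d(v) - 1`. -/
abbrev Ports (G : LabeledGraph Λ n) : Type :=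
  ∀ v : Fin n, G.graph.neighborSet v ≃ Fin (Nat.card (G.graph.neighborSet v))

/-- `σ, τ` is an isomorphism from the information a node `v` gathers in `t` rounds to the
information a node `w` gathers in `t` rounds, in graphs with port numbers and identifiers. -/
structure IsViewIso (t : ℕ) (G : LabeledGraph Λ n) (ident : Fin n → ℕ+) (p : Ports G) (v : Fin n)
    (H : LabeledGraph Λ n) (ident' : Fin n → ℕ+) (q : Ports H) (w : Fin n)
    (σ : Fin n → Fin n) (τ : Fin n → Fin n → Fin n) : Prop where
  info : IsInfoIso G (G.ball t v) H (H.ball t w) σ τ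
  root : σ v = w
  port_eq : ∀ a ∈ G.ball t v, ∀ (b : Fin n) (h : G.graph.Adj a b)
    (h' : H.graph.Adj (σ a) (τ a b)), (q (σ a) ⟨τ a b, h'⟩ : ℕ) = (p a ⟨b, h⟩ : ℕ)
  ident_eq : ∀ a ∈ G.ball t v, ident' (σ a) = ident a

/-- A deterministic `t`-round algorithm on a class `𝒞` of input-labeled graphs with identifiers,
for fixed numbers of nodes and maximum degree. For each graph of the class and each port numbering
it assigns an output to every pair `(v, e)` with `e = {v, u}`, and the output of `v` is a function
of the radius-`t` neighborhood of `v`. -/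
structure Algorithm (𝒞 : Set (LabeledGraph Λ n × (Fin n → ℕ+))) (t : ℕ) (O : Type*) where
  output : ∀ (G : LabeledGraph Λ n) (ident : Fin n → ℕ+), (G, ident) ∈ 𝒞 → Ports G →
    ∀ v u : Fin n, G.graph.Adj v u → O
  is_local : ∀ (G : LabeledGraph Λ n) (ident : Fin n → ℕ+) (hG : (G, ident) ∈ 𝒞) (p : Ports G)
    (v : Fin n) (H : LabeledGraph Λ n) (ident' : Fin n → ℕ+) (hH : (H, ident') ∈ 𝒞) (q : Ports H)
    (w : Fin n) (σ : Fin n → Fin n) (τ : Fin n → Fin n → Fin n),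
    IsViewIso t G ident p v H ident' q w σ τ →
    ∀ (u : Fin n) (h : G.graph.Adj v u) (h' : H.graph.Adj w (τ v u)),
      output H ident' hH q w (τ v u) h' = output G ident hG p v u h

namespace Algorithm

variable {O : Type*} {𝒞 : Set (LabeledGraph Λ n × (Fin n → ℕ+))} {t : ℕ}

/-- An algorithm is order-invariant if the output of a node does not change when the identifiers
are replaced by others that induce the same order on the nodes of its radius-`t` neighborhood. -/
def OrderInvariant (A : Algorithm 𝒞 t O) : Prop :=
  ∀ (G : LabeledGraph Λ n) (ident ident' : Fin n → ℕ+) (hG : (G, ident) ∈ 𝒞)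
    (hG' : (G, ident') ∈ 𝒞) (p : Ports G) (v : Fin n),
    (∀ a ∈ G.ball t v, ∀ b ∈ G.ball t v, ident a < ident b ↔ ident' a < ident' b) →
    ∀ (u : Fin n) (h : G.graph.Adj v u),
      A.output G ident hG p v u h = A.output G ident' hG' p v u h

/-- The algorithm solves the problem `P` on the class `𝒞` of graphs of maximum degree `Δ`. -/
def Solves (A : Algorithm 𝒞 t O) (P : Problem O) (Δ : ℕ) : Prop :=
  ∀ (G : LabeledGraph Λ n) (ident : Fin n → ℕ+) (hG : (G, ident) ∈ 𝒞) (p : Ports G),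
    (∀ (v u : Fin n) (h : G.graph.Adj v u), A.output G ident hG p v u h ∈ P.f Δ) ∧
    (∀ (v u : Fin n) (h : G.graph.Adj v u),
      s(A.output G ident hG p v u h, A.output G ident hG p u v h.symm) ∈ P.g Δ) ∧
    (∀ v : Fin n,
      (Finset.univ : Finset (Fin (Nat.card (G.graph.neighborSet v)))).val.map
        (fun i => A.output G ident hG p v ((p v).symm i) ((p v).symm i).2) ∈ P.h Δ)

end Algorithm

/-- There is an order-invariant algorithm solving `(P, 𝒞)` in time `t`, where `𝒞` consists of
graphs of maximum degree `Δ`. -/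
def OrderInvariantSolvable {O : Type*} (P : Problem O)
    (𝒞 : Set (LabeledGraph Λ n × (Fin n → ℕ+))) (Δ t : ℕ) : Prop :=
  ∃ A : Algorithm 𝒞 t O, A.OrderInvariant ∧ A.Solves P Δ

end LocalSpeedup

open LocalSpeedup

/-!
The proof passes through solutions computed in "`t - 1/2` rounds", where the output at a pair
`(v, e)` depends on `N^t(e)`. Replacing identifiers by their relative order turns an
order-invariant algorithm into an output assignment that is invariant under isomorphisms of
neighborhoods preserving labels, port numbers and the order of the identifiers
(`orderInvariantSolvable_iff`).

To gain half a round, `v` outputs at `e` the set of all outputs of the given algorithm over all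
extensions of `N^t(e)` to `N^t(v)` (`OutputMap.edgeHull`), and to gain another half, the set of all
these outputs over all extensions of `N^{t-1}(v)` to `N^t(e)` (`OutputMap.nodeHull`). The
constraints with an existential quantifier hold because the actual neighborhood is one of the
extensions. Those with a universal quantifier hold because arbitrary extensions, one for each
endpoint of an edge or one for each edge at a node, occur simultaneously in one network:
`t`-independence provides the graph, and `exists_amalgam` provides port numbers and identifiers on
it. For the latter, linear orders that agree on a common core are merged into one order. This
requires that the extensions meet only in the core, which for the edges at a node follows from the
girth (`LabeledGraph.edgeBall_inter_subset`). These steps are `NodeSolvable.edgeSolvable_half` and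
`EdgeSolvable.nodeSolvable_dualHalf`.

Half a round is lost again by choosing elements of the output sets that witness the existential
constraints: at an edge, both endpoints know both sets and break symmetry by comparing their
identifiers (`NodeSolvable.edgeSolvable_of_dualHalf`), and a node orders its sets by port number
(`EdgeSolvable.nodeSolvable_of_half`).

For the simplified problem, edge configurations are enlarged to maximal ones by taking polars
(`EdgeSolvable.half'`), and node configurations by choosing a maximal tuple of larger sets
(`NodeSolvable.dualHalf'`). The existential constraints survive since they are monotone. Conversely,
its solutions are solutions of `Π_1`.

If there are too few identifiers in `S` for `n` nodes, there are no networks. Otherwise any order of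
the nodes is induced by identifiers from `S`.
-/

namespace LocalSpeedup

/-! ### Short paths in graphs of large girth -/

/-- Two distinct paths between the same nodes give rise to a cycle that uses only edges of these
paths. -/
theorem egirth_le_of_paths_ne {V : Type*} {G : SimpleGraph V} {a b : V} {p q : G.Walk a b}
    (hp : p.IsPath) (hq : q.IsPath) (hne : p ≠ q) :
    G.egirth ≤ (p.length + q.length : ℕ) := by
  classical
  -- In the subgraph formed by the edges of the two paths, paths are not unique.
  set E : Set (Sym2 V) := {e | e ∈ p.edges ∨ e ∈ q.edges} with hE
  have hEG : ∀ e ∈ E, e ∈ G.edgeSet := by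
    rintro e (he | he)
    · exact p.edges_subset_edgeSet he
    · exact q.edges_subset_edgeSet he
  set H : SimpleGraph V := SimpleGraph.fromEdgeSet E with hH
  have hHE : ∀ e, e ∈ H.edgeSet ↔ e ∈ E := by
    intro e
    rw [hH, SimpleGraph.edgeSet_fromEdgeSet]
    exact ⟨fun h => h.1, fun h => ⟨h, fun hd => G.not_isDiag_of_mem_edgeSet (hEG e h) hd⟩⟩
  have hpH : ∀ e ∈ p.edges, e ∈ H.edgeSet := fun e he => (hHE e).2 (Or.inl he)
  have hqH : ∀ e ∈ q.edges, e ∈ H.edgeSet := fun e he => (hHE e).2 (Or.inr he)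
  have hcyc : ¬ H.IsAcyclic := by
    intro hac
    have h1 := (hac.subsingleton_path a b).elim ⟨p.transfer H hpH, hp.transfer hpH⟩
      ⟨q.transfer H hqH, hq.transfer hqH⟩
    have h2 : p.transfer H hpH = q.transfer H hqH := congrArg Subtype.val h1
    apply hne
    apply SimpleGraph.Walk.ext_support
    simpa using congrArg SimpleGraph.Walk.support h2
  unfold SimpleGraph.IsAcyclic at hcyc
  push Not at hcyc
  obtain ⟨v, c, hc⟩ := hcyc
  have hle : H ≤ G := by
    intro x y hxy
    exact hEG s(x, y) ((hHE s(x, y)).1 hxy)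
  have h1 := SimpleGraph.egirth_le_length (hc.mapLe hle)
  refine h1.trans ?_
  have hlen : c.length ≤ p.length + q.length := by
    have hsub : c.edges.toFinset ⊆ (p.edges ++ q.edges).toFinset := by
      intro e he
      have := (hHE e).1 (c.edges_subset_edgeSet (List.mem_toFinset.1 he))
      simpa [hE] using this
    have h2 := Finset.card_le_card hsub
    rw [List.toFinset_card_of_nodup hc.edges_nodup] at h2
    have h3 := (p.edges ++ q.edges).toFinset_card_le
    simp only [SimpleGraph.Walk.length_edges, List.length_append] at h2 h3
    omega
  rw [SimpleGraph.Walk.length_mapLe]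
  exact_mod_cast hlen

/-- In a connected graph of girth at least `2t + 2`, a node at distance at most `t` from two
distinct neighbors of `w` and from `w` itself has distance less than `t` from `w`. -/
theorem dist_lt_of_two_neighbors {V : Type*} {G : SimpleGraph V} (hG : G.Connected) {t : ℕ}
    (hgirth : ((2 * t + 2 : ℕ) : ℕ∞) ≤ G.egirth) {w y y' a : V} (hy : G.Adj w y)
    (hy' : G.Adj w y') (hne : y ≠ y') (hw : G.dist w a ≤ t) (hya : G.dist y a ≤ t)
    (hya' : G.dist y' a ≤ t) : G.dist w a < t := by
  classical
  by_contra hlt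
  have hwt : G.dist w a = t := by omega
  obtain ⟨Q, hQ, hQl⟩ := (hG w a).exists_path_of_dist
  -- A shortest path `Q` from `w` to `a` avoids one of the two neighbors in its first step.
  have key : ∀ z, G.Adj w z → G.dist z a ≤ t → Q.snd = z := by
    intro z hz hza
    obtain ⟨R, hR, hRl⟩ := (hG z a).exists_path_of_dist
    have hwR : w ∉ R.support := by
      intro hmem
      have h1 := congrArg SimpleGraph.Walk.length (R.take_spec hmem)
      rw [SimpleGraph.Walk.length_append] at h1
      have h2 := SimpleGraph.dist_le (R.dropUntil w hmem)
      have h3 : 0 < (R.takeUntil w hmem).length := by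
        rw [Nat.pos_iff_ne_zero]
        intro h0
        exact hz.ne (SimpleGraph.Walk.eq_of_length_eq_zero h0).symm
      omega
    by_contra hsnd
    have hne' : Q ≠ SimpleGraph.Walk.cons hz R := by
      intro h
      apply hsnd
      rw [h]
      simp
    have h1 := egirth_le_of_paths_ne hQ (hR.cons hwR) hne'
    have h2 := hgirth.trans h1
    rw [Nat.cast_le, SimpleGraph.Walk.length_cons] at h2
    omega
  exact hne ((key y hy hya).symm.trans (key y' hy' hya'))

/-! ### Isomorphisms of the information contained in a set of nodes -/

variable {Λ : Type*} {n : ℕ} {G H K : LabeledGraph Λ n} {A A' B B' C : Set (Fin n)}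
  {σ ρ : Fin n → Fin n} {τ κ : Fin n → Fin n → Fin n}

namespace IsInfoIso

theorem refl (G : LabeledGraph Λ n) (A : Set (Fin n)) :
    IsInfoIso G A G A id (fun _ => id) where
  nodes := Set.bijOn_id A
  edges _ _ := Set.bijOn_id _
  inner _ _ _ _ _ := rfl
  outer _ _ _ hb _ := hb
  label_eq _ _ _ _ _ := rfl

theorem adj (h : IsInfoIso G A H B σ τ) {a b : Fin n} (ha : a ∈ A) (hab : G.graph.Adj a b) :
    H.graph.Adj (σ a) (τ a b) :=
  (h.edges a ha).mapsTo hab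

theorem adj_inner (h : IsInfoIso G A H B σ τ) {a b : Fin n} (ha : a ∈ A) (hb : b ∈ A)
    (hab : G.graph.Adj a b) : H.graph.Adj (σ a) (σ b) := by
  rw [← h.inner a ha b hb hab]
  exact h.adj ha hab

theorem trans (h : IsInfoIso G A H B σ τ) (h' : IsInfoIso H B K C ρ κ) :
    IsInfoIso G A K C (ρ ∘ σ) (fun a b => κ (σ a) (τ a b)) where
  nodes := h'.nodes.comp h.nodes
  edges a ha := (h'.edges (σ a) (h.nodes.mapsTo ha)).comp (h.edges a ha)
  inner a ha b hb hab := by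
    change κ (σ a) (τ a b) = ρ (σ b)
    rw [h.inner a ha b hb hab]
    exact h'.inner _ (h.nodes.mapsTo ha) _ (h.nodes.mapsTo hb) (h.adj_inner ha hb hab)
  outer a ha b hb hab :=
    h'.outer _ (h.nodes.mapsTo ha) _ (h.outer a ha b hb hab) (h.adj ha hab)
  label_eq a ha b hab hab' := by
    have h1 := h.adj ha hab
    rw [← h.label_eq a ha b hab h1]
    exact h'.label_eq _ (h.nodes.mapsTo ha) _ h1 hab'

/-- The inverse of an isomorphism, on nodes and on the edges incident to a node. -/
theorem exists_symm (h : IsInfoIso G A H B σ τ) :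
    ∃ ρ κ, IsInfoIso H B G A ρ κ ∧ (∀ a ∈ A, ρ (σ a) = a) ∧ (∀ b ∈ B, σ (ρ b) = b) ∧
      (∀ a ∈ A, ∀ c, G.graph.Adj a c → κ (σ a) (τ a c) = c) ∧
      (∀ b ∈ B, ∀ c, H.graph.Adj b c → τ (ρ b) (κ b c) = c) := by
  classical
  have : Nonempty (Fin n) := G.connected.nonempty
  set ρ := Function.invFunOn σ A with hρ
  set κ : Fin n → Fin n → Fin n :=
    fun b => Function.invFunOn (τ (ρ b)) (G.graph.neighborSet (ρ b)) with hκ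
  have hl : ∀ a ∈ A, ρ (σ a) = a := fun a ha => h.nodes.injOn.leftInvOn_invFunOn ha
  have hr : ∀ b ∈ B, σ (ρ b) = b := fun b hb => h.nodes.surjOn.rightInvOn_invFunOn hb
  have hm : Set.MapsTo ρ B A := h.nodes.surjOn.mapsTo_invFunOn
  have hbij : Set.BijOn ρ B A := by
    refine Set.InvOn.bijOn (f' := σ) ⟨hr, hl⟩ hm h.nodes.mapsTo
  have hkl : ∀ a ∈ A, ∀ c, G.graph.Adj a c → κ (σ a) (τ a c) = c := by
    intro a ha c hac
    simp only [hκ, hl a ha]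
    exact (h.edges a ha).injOn.leftInvOn_invFunOn hac
  have hedge : ∀ b ∈ B, Set.BijOn (τ (ρ b)) (G.graph.neighborSet (ρ b))
      (H.graph.neighborSet b) := by
    intro b hb
    have := h.edges (ρ b) (hm hb)
    rwa [hr b hb] at this
  have hkr : ∀ b ∈ B, ∀ c, H.graph.Adj b c → τ (ρ b) (κ b c) = c := by
    intro b hb c hbc
    exact (hedge b hb).surjOn.rightInvOn_invFunOn hbc
  have hkm : ∀ b ∈ B, ∀ c, H.graph.Adj b c → G.graph.Adj (ρ b) (κ b c) := by
    intro b hb c hbc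
    exact (hedge b hb).surjOn.mapsTo_invFunOn hbc
  refine ⟨ρ, κ, ⟨hbij, ?_, ?_, ?_, ?_⟩, hl, hr, hkl, hkr⟩
  · intro b hb
    refine Set.InvOn.bijOn (f' := τ (ρ b)) ⟨fun c hc => hkr b hb c hc, fun c hc => ?_⟩
      (fun c hc => hkm b hb c hc) (hedge b hb).mapsTo
    exact (hedge b hb).injOn.leftInvOn_invFunOn hc
  · intro b hb c hc hbc
    have h1 := hkm b hb c hbc
    have h2 := hkr b hb c hbc
    by_cases hmem : κ b c ∈ A
    · rw [h.inner _ (hm hb) _ hmem h1] at h2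
      have h3 := hl _ hmem
      rw [h2] at h3
      exact h3.symm
    · exact absurd (h2.symm ▸ hc : τ (ρ b) (κ b c) ∈ B) (h.outer _ (hm hb) _ hmem h1)
  · intro b hb c hc hbc hmem
    have h1 := hkm b hb c hbc
    have h2 := hkr b hb c hbc
    rw [h.inner _ (hm hb) _ hmem h1] at h2
    exact hc (h2 ▸ h.nodes.mapsTo hmem)
  · intro b hb c hbc hbc'
    have h1 := h.label_eq (ρ b) (hm hb) (κ b c) hbc' (h.adj (hm hb) hbc')
    rw [← h1]
    congr 1
    · exact hr b hb
    · exact hkr b hb c hbc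

theorem restrict (h : IsInfoIso G A H B σ τ) (hA : A' ⊆ A) (hB : B' ⊆ B)
    (hbij : Set.BijOn σ A' B') : IsInfoIso G A' H B' σ τ where
  nodes := hbij
  edges a ha := h.edges a (hA ha)
  inner a ha b hb := h.inner a (hA ha) b (hA hb)
  outer a ha b hb hab hmem := by
    by_cases hbA : b ∈ A
    · rw [h.inner a (hA ha) b hbA hab] at hmem
      obtain ⟨c, hc, hcb⟩ := hbij.surjOn hmem
      exact hb (h.nodes.injOn (hA hc) hbA hcb ▸ hc)
    · exact h.outer a (hA ha) b hbA hab (hB hmem)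
  label_eq a ha := h.label_eq a (hA ha)

/-- Isomorphisms do not increase the length of walks inside the set on which they are defined. -/
theorem dist_le_length (h : IsInfoIso G A H B σ τ) {x y : Fin n} (p : G.graph.Walk x y)
    (hp : ∀ z ∈ p.support, z ∈ A) : H.graph.dist (σ x) (σ y) ≤ p.length := by
  suffices h : ∃ q : H.graph.Walk (σ x) (σ y), q.length = p.length by
    obtain ⟨q, hq⟩ := h
    exact hq ▸ SimpleGraph.dist_le q
  induction p with
  | nil => exact ⟨.nil, rfl⟩
  | @cons x z y hxz p ih =>
    obtain ⟨q, hq⟩ := ih fun z hz => hp z (by simp [hz])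
    refine ⟨.cons (h.adj_inner (hp _ (by simp)) (hp _ ?_) hxz) q, by simp [hq]⟩
    simp

end IsInfoIso

/-! ### Neighborhoods of nodes and edges -/

namespace LabeledGraph

theorem edgeBall_comm (G : LabeledGraph Λ n) (t : ℕ) (u v : Fin n) :
    G.edgeBall t u v = G.edgeBall t v u := Set.inter_comm _ _

theorem self_mem_ball (G : LabeledGraph Λ n) (t : ℕ) (v : Fin n) : v ∈ G.ball t v := by
  simp [ball]

theorem adj_mem_ball (G : LabeledGraph Λ n) {t : ℕ} (ht : 1 ≤ t) {v u : Fin n}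
    (h : G.graph.Adj v u) : u ∈ G.ball t v := by
  change G.graph.dist v u ≤ t
  rw [SimpleGraph.dist_eq_one_iff_adj.2 h]
  exact ht

theorem left_mem_edgeBall (G : LabeledGraph Λ n) {t : ℕ} (ht : 1 ≤ t) {v u : Fin n}
    (h : G.graph.Adj v u) : v ∈ G.edgeBall t v u :=
  ⟨G.self_mem_ball t v, G.adj_mem_ball ht h.symm⟩

theorem right_mem_edgeBall (G : LabeledGraph Λ n) {t : ℕ} (ht : 1 ≤ t) {v u : Fin n}
    (h : G.graph.Adj v u) : u ∈ G.edgeBall t v u :=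
  ⟨G.adj_mem_ball ht h, G.self_mem_ball t u⟩

theorem dist_le_dist_add_one (G : LabeledGraph Λ n) {v u : Fin n} (h : G.graph.Adj v u)
    (a : Fin n) : G.graph.dist u a ≤ G.graph.dist v a + 1 := by
  have h1 := G.connected.dist_triangle (u := u) (v := v) (w := a)
  have h2 := SimpleGraph.dist_eq_one_iff_adj.2 h.symm
  omega

theorem ball_pred_subset_edgeBall (G : LabeledGraph Λ n) {t : ℕ} (ht : 1 ≤ t) {v u : Fin n}
    (h : G.graph.Adj v u) : G.ball (t - 1) v ⊆ G.edgeBall t v u := by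
  intro a ha
  have ha : G.graph.dist v a ≤ t - 1 := ha
  have h1 := G.dist_le_dist_add_one h a
  exact ⟨show G.graph.dist v a ≤ t by omega, show G.graph.dist u a ≤ t by omega⟩

/-- Large girth makes the extensions of `N^{t-1}(w)` along different edges disjoint. -/
theorem edgeBall_inter_subset (G : LabeledGraph Λ n) {t : ℕ}
    (hgirth : ((2 * t + 2 : ℕ) : ℕ∞) ≤ G.graph.egirth) {w y y' : Fin n} (hy : G.graph.Adj w y)
    (hy' : G.graph.Adj w y') (hne : y ≠ y') :
    G.edgeBall t w y ∩ G.edgeBall t w y' ⊆ G.ball (t - 1) w := by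
  rintro a ⟨⟨h1, h2⟩, -, h3⟩
  have := dist_lt_of_two_neighbors G.connected hgirth hy hy' hne h1 h2 h3
  change G.graph.dist w a ≤ t - 1
  omega

end LabeledGraph

namespace IsInfoIso

theorem bijOn_of_mapsTo (h : IsInfoIso G A H B σ τ) (hA : A' ⊆ A)
    (h1 : Set.MapsTo σ A' B') (h2 : ∀ b ∈ B', ∃ a ∈ A', σ a = b) : Set.BijOn σ A' B' :=
  ⟨h1, h.nodes.injOn.mono hA, h2⟩

theorem mapsTo_ball (h : IsInfoIso G A H B σ τ) {r : ℕ} {v : Fin n} (hA : G.ball r v ⊆ A) :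
    Set.MapsTo σ (G.ball r v) (H.ball r (σ v)) := by
  intro a ha
  have ha' : G.graph.dist v a ≤ r := ha
  obtain ⟨p, hp⟩ := G.connected.exists_walk_length_eq_dist v a
  refine (h.dist_le_length p fun z hz => hA ?_).trans (hp ▸ ha')
  have h1 := SimpleGraph.dist_le (p.takeUntil z hz)
  have h2 := p.length_takeUntil_le_length hz
  change G.graph.dist v z ≤ r
  omega

theorem restrict_ball (h : IsInfoIso G A H B σ τ) {r : ℕ} {v : Fin n} (hA : G.ball r v ⊆ A)
    (hB : H.ball r (σ v) ⊆ B) : IsInfoIso G (G.ball r v) H (H.ball r (σ v)) σ τ := by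
  refine h.restrict hA hB (h.bijOn_of_mapsTo hA (h.mapsTo_ball hA) fun b hb => ?_)
  obtain ⟨ρ, κ, hs, h1, h2, -, -⟩ := h.exists_symm
  have h3 := hs.mapsTo_ball hB hb
  rw [h1 v (hA (G.self_mem_ball r v))] at h3
  exact ⟨ρ b, h3, h2 b (hB hb)⟩

/-- A shortest path that witnesses membership in `N^t(e)` stays inside `N^t(v)`, for `v` an
endpoint of `e`. -/
theorem mapsTo_edgeBall {t : ℕ} {v u : Fin n} {w : Fin n}
    (h : IsInfoIso G (G.ball t v) H (H.ball t w) σ τ) (hu : G.graph.Adj v u) :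
    Set.MapsTo σ (G.edgeBall t v u) (H.edgeBall t w (σ u)) := by
  rintro a ⟨hva, hua⟩
  refine ⟨h.nodes.mapsTo hva, ?_⟩
  have hua' : G.graph.dist u a ≤ t := hua
  obtain ⟨p, hp⟩ := G.connected.exists_walk_length_eq_dist u a
  refine (h.dist_le_length p fun z hz => ?_).trans (hp ▸ hua')
  by_cases hza : z = a
  · exact hza ▸ hva
  have h1 := SimpleGraph.dist_le (p.takeUntil z hz)
  have h2 := p.length_takeUntil_lt_length hz hza
  have h3 := G.dist_le_dist_add_one hu.symm z
  change G.graph.dist v z ≤ t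
  omega

theorem restrict_edgeBall {t : ℕ} (ht : 1 ≤ t) {v u w : Fin n}
    (h : IsInfoIso G (G.ball t v) H (H.ball t w) σ τ) (hw : σ v = w) (hu : G.graph.Adj v u) :
    IsInfoIso G (G.edgeBall t v u) H (H.edgeBall t w (σ u)) σ τ := by
  have hA : G.edgeBall t v u ⊆ G.ball t v := Set.inter_subset_left
  refine h.restrict hA Set.inter_subset_left
    (h.bijOn_of_mapsTo hA (h.mapsTo_edgeBall hu) fun b hb => ?_)
  obtain ⟨ρ, κ, hs, h1, h2, -, -⟩ := h.exists_symm
  have hadj : H.graph.Adj w (σ u) :=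
    hw ▸ h.adj_inner (G.self_mem_ball t v) (G.adj_mem_ball ht hu) hu
  have h3 := hs.mapsTo_edgeBall hadj hb
  rw [h1 u (G.adj_mem_ball ht hu)] at h3
  exact ⟨ρ b, h3, h2 b hb.1⟩

end IsInfoIso

end LocalSpeedup

namespace LocalSpeedup

/-! ### Networks, their isomorphisms and invariant output assignments -/

/-- A graph of the class `𝒞` with its identifiers, together with a port numbering. -/
structure Network {Λ : Type*} {n : ℕ} (𝒞 : Set (LabeledGraph Λ n × (Fin n → ℕ+))) where
  G : LabeledGraph Λ n
  ident : Fin n → ℕ+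
  mem : (G, ident) ∈ 𝒞
  ports : Ports G

/-- An assignment of an output to every pair `(v, {v, u})` of every network, not yet subject to
any locality condition. -/
abbrev OutputMap {Λ : Type*} {n : ℕ} (𝒞 : Set (LabeledGraph Λ n × (Fin n → ℕ+)))
    (X : Type*) : Type _ :=
  ∀ (N : Network 𝒞) (v u : Fin n), N.G.graph.Adj v u → X

variable {Λ : Type*} {n : ℕ} {𝒞 : Set (LabeledGraph Λ n × (Fin n → ℕ+))}
  {M N K : Network 𝒞} {A A' B B' C : Set (Fin n)}
  {σ ρ : Fin n → Fin n} {τ κ : Fin n → Fin n → Fin n} {X Y : Type*} {t : ℕ}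

/-- `σ`, `τ` form an isomorphism from the information contained in `A` to that contained in `B`,
including port numbers and the relative order of the identifiers, but not their values. -/
structure IsOrderIso (M : Network 𝒞) (A : Set (Fin n)) (N : Network 𝒞) (B : Set (Fin n))
    (σ : Fin n → Fin n) (τ : Fin n → Fin n → Fin n) : Prop where
  info : IsInfoIso M.G A N.G B σ τ
  port_eq : ∀ a ∈ A, ∀ (b : Fin n) (h : M.G.graph.Adj a b)
    (h' : N.G.graph.Adj (σ a) (τ a b)),
    (N.ports (σ a) ⟨τ a b, h'⟩ : ℕ) = (M.ports a ⟨b, h⟩ : ℕ)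
  lt_iff : ∀ a ∈ A, ∀ b ∈ A, N.ident (σ a) < N.ident (σ b) ↔ M.ident a < M.ident b

theorem ports_congr {G : LabeledGraph Λ n} (p : Ports G) {a a' b b' : Fin n} (ha : a = a')
    (hb : b = b') (h : G.graph.Adj a b) (h' : G.graph.Adj a' b') :
    (p a ⟨b, h⟩ : ℕ) = p a' ⟨b', h'⟩ := by
  subst ha hb
  rfl

namespace IsOrderIso

theorem refl (M : Network 𝒞) (A : Set (Fin n)) : IsOrderIso M A M A id (fun _ => id) where
  info := IsInfoIso.refl M.G A
  port_eq _ _ _ _ _ := rfl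
  lt_iff _ _ _ _ := Iff.rfl

theorem trans (h : IsOrderIso M A N B σ τ) (h' : IsOrderIso N B K C ρ κ) :
    IsOrderIso M A K C (ρ ∘ σ) (fun a b => κ (σ a) (τ a b)) where
  info := h.info.trans h'.info
  port_eq a ha b hab hab' := by
    have h1 := h.info.adj ha hab
    rw [← h.port_eq a ha b hab h1]
    exact h'.port_eq _ (h.info.nodes.mapsTo ha) _ h1 hab'
  lt_iff a ha b hb := by
    rw [← h.lt_iff a ha b hb]
    exact h'.lt_iff _ (h.info.nodes.mapsTo ha) _ (h.info.nodes.mapsTo hb)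

theorem exists_symm (h : IsOrderIso M A N B σ τ) :
    ∃ ρ κ, IsOrderIso N B M A ρ κ ∧ (∀ a ∈ A, ρ (σ a) = a) ∧
      (∀ a ∈ A, ∀ c, M.G.graph.Adj a c → κ (σ a) (τ a c) = c) := by
  obtain ⟨ρ, κ, hs, h1, h2, h3, h4⟩ := h.info.exists_symm
  refine ⟨ρ, κ, ⟨hs, ?_, ?_⟩, h1, h3⟩
  · intro b hb c hbc hbc'
    have h5 := h.port_eq (ρ b) (hs.nodes.mapsTo hb) (κ b c) hbc'
      (h.info.adj (hs.nodes.mapsTo hb) hbc')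
    rw [← h5]
    exact ports_congr N.ports (h2 b hb) (h4 b hb c hbc) _ _
  · intro a ha b hb
    have h5 := h.lt_iff _ (hs.nodes.mapsTo ha) _ (hs.nodes.mapsTo hb)
    rw [h2 a ha, h2 b hb] at h5
    exact h5.symm

theorem restrict (h : IsOrderIso M A N B σ τ) (hA : A' ⊆ A)
    (hinfo : IsInfoIso M.G A' N.G B' σ τ) : IsOrderIso M A' N B' σ τ where
  info := hinfo
  port_eq a ha := h.port_eq a (hA ha)
  lt_iff a ha b hb := h.lt_iff a (hA ha) b (hA hb)

end IsOrderIso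

/-- The output at `(v, e)` depends only on `N^t(v)`, port numbers and the order of the
identifiers. -/
def NodeInvariant (t : ℕ) (F : OutputMap 𝒞 X) : Prop :=
  ∀ (M N : Network 𝒞) (v w : Fin n) (σ : Fin n → Fin n) (τ : Fin n → Fin n → Fin n),
    IsOrderIso M (M.G.ball t v) N (N.G.ball t w) σ τ → σ v = w →
    ∀ (u : Fin n) (h : M.G.graph.Adj v u) (h' : N.G.graph.Adj w (τ v u)),
      F N w (τ v u) h' = F M v u h

/-- The output at `(v, e)` depends only on `N^t(e)`, port numbers and the order of the
identifiers. -/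
def EdgeInvariant (t : ℕ) (F : OutputMap 𝒞 X) : Prop :=
  ∀ (M N : Network 𝒞) (v u w x : Fin n) (h : M.G.graph.Adj v u) (h' : N.G.graph.Adj w x)
    (σ : Fin n → Fin n) (τ : Fin n → Fin n → Fin n),
    IsOrderIso M (M.G.edgeBall t v u) N (N.G.edgeBall t w x) σ τ → σ v = w → σ u = x →
      F N w x h' = F M v u h

theorem NodeInvariant.edgeInvariant {F : OutputMap 𝒞 X} (ht : 1 ≤ t)
    (hF : NodeInvariant (t - 1) F) : EdgeInvariant t F := by
  rintro M N v u w x h h' σ τ hiso rfl rfl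
  have h1 := hiso.restrict (M.G.ball_pred_subset_edgeBall ht h)
    (hiso.info.restrict_ball (M.G.ball_pred_subset_edgeBall ht h)
      (N.G.ball_pred_subset_edgeBall ht h'))
  have h2 := hiso.info.inner v (M.G.left_mem_edgeBall ht h) u (M.G.right_mem_edgeBall ht h) h
  have h3 := hF M N v (σ v) σ τ h1 rfl u h (h2 ▸ h')
  rw [← h3]
  congr 1
  exact h2.symm

theorem EdgeInvariant.nodeInvariant {F : OutputMap 𝒞 X} (ht : 1 ≤ t)
    (hF : EdgeInvariant t F) : NodeInvariant t F := by
  intro M N v w σ τ hiso hw u h h'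
  have h2 := hiso.info.inner v (M.G.self_mem_ball t v) u (M.G.adj_mem_ball ht h) h
  have h1 := hiso.restrict Set.inter_subset_left (hiso.info.restrict_edgeBall ht hw h)
  rw [← h2] at h1
  exact hF M N v u w (τ v u) h h' σ τ h1 hw h2.symm

/-- The outputs of the node `v`, indexed by its ports. -/
noncomputable def OutputMap.tuple (F : OutputMap 𝒞 X) (N : Network 𝒞) (v : Fin n)
    (i : Fin (Nat.card (N.G.graph.neighborSet v))) : X :=
  F N v ((N.ports v).symm i) ((N.ports v).symm i).2

/-- The multiset of the outputs of the node `v`. -/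
noncomputable def OutputMap.config (F : OutputMap 𝒞 X) (N : Network 𝒞) (v : Fin n) : Multiset X :=
  Finset.univ.val.map (F.tuple N v)

theorem OutputMap.tuple_ports (F : OutputMap 𝒞 X) (N : Network 𝒞) {v u : Fin n}
    (h : N.G.graph.Adj v u) : F.tuple N v (N.ports v ⟨u, h⟩) = F N v u h := by
  have h1 : ∀ x y : N.G.graph.neighborSet v, x = y → F N v x x.2 = F N v y y.2 := by
    rintro x _ rfl
    rfl
  exact h1 _ ⟨u, h⟩ ((N.ports v).symm_apply_apply _)

/-- The outputs `F` form a solution of `P` on every network. -/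
structure OutputMap.Solves (F : OutputMap 𝒞 X) (P : Problem X) (Δ : ℕ) : Prop where
  mem_f : ∀ (N : Network 𝒞) (v u : Fin n) (h : N.G.graph.Adj v u), F N v u h ∈ P.f Δ
  mem_g : ∀ (N : Network 𝒞) (v u : Fin n) (h : N.G.graph.Adj v u),
    s(F N v u h, F N u v h.symm) ∈ P.g Δ
  mem_h : ∀ (N : Network 𝒞) (v : Fin n), F.config N v ∈ P.h Δ

/-- `P` has an order-invariant solution in which the output at `(v, e)` depends on `N^t(v)`. -/
def NodeSolvable (P : Problem X) (𝒞 : Set (LabeledGraph Λ n × (Fin n → ℕ+))) (Δ t : ℕ) : Prop :=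
  ∃ F : OutputMap 𝒞 X, NodeInvariant t F ∧ F.Solves P Δ

/-- `P` has an order-invariant solution in which the output at `(v, e)` depends on `N^t(e)`;
for positive `t`, this means that it can be found in `t - 1/2` rounds. -/
def EdgeSolvable (P : Problem X) (𝒞 : Set (LabeledGraph Λ n × (Fin n → ℕ+))) (Δ t : ℕ) : Prop :=
  ∃ F : OutputMap 𝒞 X, EdgeInvariant t F ∧ F.Solves P Δ

/-! ### Order-invariant algorithms as invariant output assignments -/

section Ids

variable {𝒢 : Set (LabeledGraph Λ n)} {S : Finset ℕ+}

/-- Identifiers of `H` that agree with those of `G` along an injection `σ` of a set of nodes. -/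
theorem exists_ident_extending {ident : Fin n → ℕ+} (hinj : Function.Injective ident)
    (hS : ∀ v, ident v ∈ S) (hσ : Set.InjOn σ A) :
    ∃ ident' : Fin n → ℕ+, Function.Injective ident' ∧ (∀ v, ident' v ∈ S) ∧
      ∀ a ∈ A, ident' (σ a) = ident a := by
  classical
  by_cases hn : Nonempty (Fin n)
  swap
  · exact ⟨ident, hinj, hS, fun a _ => (hn ⟨a⟩).elim⟩
  set T : Finset ℕ+ := Finset.univ.image ident with hT
  have hcard : Fintype.card (Fin n) = T.card := by
    rw [hT, Finset.card_image_of_injective _ hinj, Finset.card_univ]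
  have hl : ∀ a ∈ A, Function.invFunOn σ A (σ a) = a :=
    fun a ha => hσ.leftInvOn_invFunOn ha
  have hm : ∀ a ∈ A, σ a ∈ Finset.univ.filter (· ∈ σ '' A) := fun a ha => by
    simpa using ⟨a, ha, rfl⟩
  obtain ⟨g, hg⟩ := Finset.exists_equiv_extend_of_card_eq (t := T) hcard
    (s := Finset.univ.filter (· ∈ σ '' A)) (f := fun b => ident (Function.invFunOn σ A b))
    (by
      intro x hx
      obtain ⟨b, -, rfl⟩ := Finset.mem_image.1 hx
      exact Finset.mem_image_of_mem _ (Finset.mem_univ _))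
    (by
      intro b hb c hc hbc
      obtain ⟨a, ha, rfl⟩ : b ∈ σ '' A := by simpa using hb
      obtain ⟨a', ha', rfl⟩ : c ∈ σ '' A := by simpa using hc
      have := hinj hbc
      rw [hl a ha, hl a' ha'] at this
      rw [this])
  refine ⟨fun v => g v, Subtype.val_injective.comp g.injective, fun v => ?_, fun a ha => ?_⟩
  · obtain ⟨w, -, hw⟩ := Finset.mem_image.1 (g v).2
    change (g v : ℕ+) ∈ S
    exact hw ▸ hS w
  · change (g (σ a) : ℕ+) = _
    rw [hg _ (hm a ha), hl a ha]

theorem orderInvariantSolvable_iff (P : Problem X) (Δ t : ℕ) :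
    OrderInvariantSolvable P (withIds 𝒢 S) Δ t ↔ NodeSolvable P (withIds 𝒢 S) Δ t := by
  constructor
  · rintro ⟨alg, hinv, hsol⟩
    refine ⟨fun N v u h => alg.output N.G N.ident N.mem N.ports v u h, ?_,
      fun N => (hsol N.G N.ident N.mem N.ports).1,
      fun N => (hsol N.G N.ident N.mem N.ports).2.1,
      fun N => (hsol N.G N.ident N.mem N.ports).2.2⟩
    rintro M N v w σ τ hiso hw u h h'
    -- Replace the identifiers of `N` by those of `M`, which does not affect the output.
    obtain ⟨ident', hinj, hS, hid⟩ :=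
      exists_ident_extending M.mem.2.1 M.mem.2.2 hiso.info.nodes.injOn
    have hmem : (N.G, ident') ∈ withIds 𝒢 S := ⟨N.mem.1, hinj, hS⟩
    have h1 := hinv N.G N.ident ident' N.mem hmem N.ports w (by
      intro b hb c hc
      obtain ⟨a, ha, rfl⟩ := hiso.info.nodes.surjOn hb
      obtain ⟨a', ha', rfl⟩ := hiso.info.nodes.surjOn hc
      rw [hid a ha, hid a' ha']
      exact hiso.lt_iff a ha a' ha') (τ v u) h'
    exact h1.trans (alg.is_local M.G M.ident M.mem M.ports v N.G ident' hmem N.ports w σ τ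
      ⟨hiso.info, hw, hiso.port_eq, hid⟩ u h h')
  · rintro ⟨F, hF, hsol⟩
    refine ⟨⟨fun G ident hG p v u h => F ⟨G, ident, hG, p⟩ v u h, ?_⟩, ?_, ?_⟩
    · intro G ident hG p v H ident' hH q w σ τ hiso u h h'
      refine hF ⟨G, ident, hG, p⟩ ⟨H, ident', hH, q⟩ v w σ τ
        ⟨hiso.info, hiso.port_eq, fun a ha b hb => ?_⟩ hiso.root u h h'
      change ident' (σ a) < ident' (σ b) ↔ ident a < ident b
      rw [hiso.ident_eq a ha, hiso.ident_eq b hb]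
    · intro G ident ident' hG hG' p v hlt u h
      exact (hF ⟨G, ident, hG, p⟩ ⟨G, ident', hG', p⟩ v v id (fun _ => id)
        ⟨IsInfoIso.refl G _, fun _ _ _ _ _ => rfl, fun a ha b hb => (hlt a ha b hb).symm⟩
        rfl u h h).symm
    · intro G ident hG p
      exact ⟨hsol.mem_f ⟨G, ident, hG, p⟩, hsol.mem_g ⟨G, ident, hG, p⟩,
        hsol.mem_h ⟨G, ident, hG, p⟩⟩

end Ids

/-! ### Post-processing of outputs -/

/-- Recompute the outputs of an edge from its two outputs, breaking symmetry by means of the order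
of the identifiers of its endpoints. -/
noncomputable def OutputMap.edgeMap (φ ψ : X → X → Y) (F : OutputMap 𝒞 X) : OutputMap 𝒞 Y :=
  fun N v u h => open Classical in
    if N.ident v < N.ident u then φ (F N v u h) (F N u v h.symm)
    else ψ (F N u v h.symm) (F N v u h)

theorem EdgeInvariant.edgeMap {F : OutputMap 𝒞 X} (ht : 1 ≤ t) (hF : EdgeInvariant t F)
    (φ ψ : X → X → Y) : EdgeInvariant t (F.edgeMap φ ψ) := by
  intro M N v u w x h h' σ τ hiso hw hx
  have h1 := hF M N v u w x h h' σ τ hiso hw hx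
  have h2 := hF M N u v x w h.symm h'.symm σ τ
    (by rwa [M.G.edgeBall_comm, N.G.edgeBall_comm]) hx hw
  have h3 := hiso.lt_iff v (M.G.left_mem_edgeBall ht h) u (M.G.right_mem_edgeBall ht h)
  rw [hw, hx] at h3
  simp only [OutputMap.edgeMap, h1, h2, h3]

/-- The pair of outputs of `F.edgeMap` at an edge has the form `{φ a b, ψ a b}`. -/
theorem OutputMap.edgeMap_pair {F : OutputMap 𝒞 X} {φ ψ : X → X → Y} {N : Network 𝒞}
    (hinj : Function.Injective N.ident) {v u : Fin n} (h : N.G.graph.Adj v u) :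
    (F.edgeMap φ ψ N v u h = φ (F N v u h) (F N u v h.symm) ∧
      F.edgeMap φ ψ N u v h.symm = ψ (F N v u h) (F N u v h.symm)) ∨
    (F.edgeMap φ ψ N u v h.symm = φ (F N u v h.symm) (F N v u h) ∧
      F.edgeMap φ ψ N v u h = ψ (F N u v h.symm) (F N v u h)) := by
  rcases lt_or_gt_of_ne (hinj.ne h.ne) with hlt | hlt
  · exact Or.inl ⟨if_pos hlt, if_neg hlt.asymm⟩
  · exact Or.inr ⟨if_pos hlt, if_neg hlt.asymm⟩

/-- Recompute the outputs of a node from its tuple of outputs. -/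
noncomputable def OutputMap.portMap (sel : ∀ d : ℕ, (Fin d → X) → Fin d → Y) (F : OutputMap 𝒞 X) :
    OutputMap 𝒞 Y :=
  fun N v u h => sel _ (F.tuple N v) (N.ports v ⟨u, h⟩)

theorem OutputMap.config_portMap (sel : ∀ d : ℕ, (Fin d → X) → Fin d → Y) (F : OutputMap 𝒞 X)
    (N : Network 𝒞) (v : Fin n) :
    (F.portMap sel).config N v = Finset.univ.val.map (sel _ (F.tuple N v)) := by
  unfold OutputMap.config
  congr 1
  funext i
  exact congrArg (sel _ (F.tuple N v)) ((N.ports v).apply_symm_apply i)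

theorem IsInfoIso.card_neighborSet {G H : LabeledGraph Λ n} (h : IsInfoIso G A H B σ τ)
    {a : Fin n} (ha : a ∈ A) :
    Nat.card (G.graph.neighborSet a) = Nat.card (H.graph.neighborSet (σ a)) :=
  Nat.card_congr (h.edges a ha).equiv

theorem NodeInvariant.portMap {F : OutputMap 𝒞 X} (hF : NodeInvariant t F)
    (sel : ∀ d : ℕ, (Fin d → X) → Fin d → Y) : NodeInvariant t (F.portMap sel) := by
  rintro M N v w σ τ hiso rfl u h h'
  have hv := M.G.self_mem_ball t v
  have aux : ∀ (d d' : ℕ), d = d' → ∀ (f : Fin d → X) (f' : Fin d' → X),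
      (∀ (i : Fin d) (j : Fin d'), (j : ℕ) = i → f' j = f i) →
      ∀ (i : Fin d) (j : Fin d'), (j : ℕ) = i → sel d' f' j = sel d f i := by
    rintro d _ rfl f f' hff i j hij
    obtain rfl : j = i := Fin.ext hij
    obtain rfl : f' = f := funext fun i => hff i i rfl
    rfl
  refine aux _ _ (hiso.info.card_neighborSet hv) _ _ (fun i j hij => ?_) _ _
    (hiso.port_eq v hv u h h')
  obtain ⟨⟨c, hc⟩, rfl⟩ := (M.ports v).surjective i
  have hc' := hiso.info.adj hv hc
  obtain rfl : j = N.ports (σ v) ⟨τ v c, hc'⟩ :=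
    Fin.ext (hij.trans (hiso.port_eq v hv c hc hc').symm)
  refine (F.tuple_ports N hc').trans (Eq.trans ?_ (F.tuple_ports M hc).symm)
  exact hF M N v (σ v) σ τ hiso rfl c hc hc'

/-! ### Choosing labels from sets of labels -/

/-- A multiset of representatives of an indexed family comes from an indexed choice. -/
theorem exists_map_of_rel {α ι : Type*} {r : α → ι → Prop} {m : Multiset α} {s : Multiset ι}
    (h : Multiset.Rel r m s) (hs : s.Nodup) [Nonempty (ι → α)] :
    ∃ c : ι → α, m = s.map c ∧ ∀ i ∈ s, r (c i) i := by
  classical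
  induction h with
  | zero => exact ⟨Classical.arbitrary _, by simp, by simp⟩
  | @cons a i m s hai _ ih =>
    obtain ⟨c, rfl, hc⟩ := ih (Multiset.nodup_cons.1 hs).2
    have his := (Multiset.nodup_cons.1 hs).1
    have hne : ∀ j ∈ s, j ≠ i := fun j hj hji => his (hji ▸ hj)
    refine ⟨Function.update c i a, ?_, fun j hj => ?_⟩
    · rw [Multiset.map_cons, Function.update_self]
      congr 1
      exact Multiset.map_congr rfl fun j hj => by rw [Function.update_of_ne (hne j hj)]
    · rcases Multiset.mem_cons.1 hj with rfl | hj
      · rwa [Function.update_self]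
      · rw [Function.update_of_ne (hne j hj)]
        exact hc j hj

theorem rel_map_univ_iff {α : Type*} {d : ℕ} {m : Multiset α} {f : Fin d → Set α} :
    Multiset.Rel (fun y Y => y ∈ Y) m (Finset.univ.val.map f) ↔
      ∃ c : Fin d → α, m = Finset.univ.val.map c ∧ ∀ i, c i ∈ f i := by
  constructor
  · intro h
    rw [Multiset.rel_map_right] at h
    have : Nonempty (Fin d → α) := by
      by_cases hα : Nonempty α
      · infer_instance
      · have hm : m = 0 := Multiset.eq_zero_of_forall_notMem fun a _ => hα ⟨a⟩
        subst hm
        have h0 := Multiset.rel_zero_left.1 h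
        have : IsEmpty (Fin d) := ⟨fun i => by
          have := Finset.mem_univ i
          rw [← Finset.mem_val, h0] at this
          simp at this⟩
        infer_instance
    obtain ⟨c, h1, h2⟩ := exists_map_of_rel h Finset.univ.nodup
    exact ⟨c, h1, fun i => h2 i (Finset.mem_univ i)⟩
  · rintro ⟨c, rfl, hc⟩
    rw [Multiset.rel_map_right, Multiset.rel_map_left]
    exact Multiset.rel_refl_of_refl_on fun i _ => hc i

namespace Problem

variable (P : Problem X) (Δ : ℕ)

theorem nodeExists_map_iff {d : ℕ} {f : Fin d → Set X} :
    P.NodeExists Δ (Finset.univ.val.map f) ↔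
      ∃ c : Fin d → X, (∀ i, c i ∈ f i) ∧ Finset.univ.val.map c ∈ P.h Δ := by
  simp only [NodeExists, rel_map_univ_iff]
  constructor
  · rintro ⟨_, ⟨c, rfl, hc⟩, h⟩
    exact ⟨c, hc, h⟩
  · rintro ⟨c, hc, h⟩
    exact ⟨_, ⟨c, rfl, hc⟩, h⟩

theorem nodeForall_map_iff {d : ℕ} {f : Fin d → Set X} :
    P.NodeForall Δ (Finset.univ.val.map f) ↔
      ∀ c : Fin d → X, (∀ i, c i ∈ f i) → Finset.univ.val.map c ∈ P.h Δ := by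
  simp only [NodeForall, rel_map_univ_iff]
  exact ⟨fun h c hc => h _ ⟨c, rfl, hc⟩, by rintro h _ ⟨c, rfl, hc⟩; exact h c hc⟩

variable {P Δ}

theorem EdgeExists.symm {Y Z : Set X} (h : P.EdgeExists Δ Y Z) : P.EdgeExists Δ Z Y := by
  obtain ⟨y, hy, z, hz, h⟩ := h
  exact ⟨z, hz, y, hy, Sym2.eq_swap ▸ h⟩

theorem EdgeForall.symm {Y Z : Set X} (h : P.EdgeForall Δ Y Z) : P.EdgeForall Δ Z Y :=
  fun z hz y hy => Sym2.eq_swap ▸ h y hy z hz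

/-- For a symmetric edge predicate, membership in the edge constraint can be read off any
ordering of the pair. -/
theorem mem_powerProblem_g {E : ℕ → Set X → Set X → Prop} {Nd : ℕ → Multiset (Set X) → Prop}
    (hE : ∀ Y Z, E Δ Y Z → E Δ Z Y) {Y Z : Set X} :
    s(Y, Z) ∈ (P.powerProblem E Nd).g Δ ↔ Y ⊆ P.f Δ ∧ Z ⊆ P.f Δ ∧ E Δ Y Z := by
  constructor
  · rintro ⟨Y', Z', heq, h1, h2, h3⟩
    rcases Sym2.eq_iff.1 heq with ⟨rfl, rfl⟩ | ⟨rfl, rfl⟩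
    · exact ⟨h1, h2, h3⟩
    · exact ⟨h2, h1, hE _ _ h3⟩
  · rintro ⟨h1, h2, h3⟩
    exact ⟨Y, Z, rfl, h1, h2, h3⟩

theorem mem_half_g {Y Z : Set X} :
    s(Y, Z) ∈ P.half.g Δ ↔ Y ⊆ P.f Δ ∧ Z ⊆ P.f Δ ∧ P.EdgeForall Δ Y Z :=
  mem_powerProblem_g fun _ _ h => h.symm

theorem mem_dualHalf_g {Y Z : Set X} :
    s(Y, Z) ∈ P.dualHalf.g Δ ↔ Y ⊆ P.f Δ ∧ Z ⊆ P.f Δ ∧ P.EdgeExists Δ Y Z :=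
  mem_powerProblem_g fun _ _ h => h.symm

theorem mem_dualHalf'_g {Y Z : Set X} :
    s(Y, Z) ∈ P.dualHalf'.g Δ ↔ Y ⊆ P.f Δ ∧ Z ⊆ P.f Δ ∧ P.EdgeExists Δ Y Z :=
  mem_powerProblem_g fun _ _ h => h.symm

theorem NodeExists.mono {d : ℕ} {f f' : Fin d → Set X}
    (h : P.NodeExists Δ (Finset.univ.val.map f)) (hf : ∀ i, f i ⊆ f' i) :
    P.NodeExists Δ (Finset.univ.val.map f') := by
  rw [nodeExists_map_iff] at h ⊢
  obtain ⟨c, hc, h⟩ := h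
  exact ⟨c, fun i => hf i (hc i), h⟩

/-- The largest set of labels that is compatible with all labels of `Z`. -/
def polar (P : Problem X) (Δ : ℕ) (Z : Set X) : Set X :=
  {y ∈ P.f Δ | ∀ z ∈ Z, s(y, z) ∈ P.g Δ}

theorem subset_polar_iff {Y Z : Set X} (hY : Y ⊆ P.f Δ) :
    Y ⊆ P.polar Δ Z ↔ P.EdgeForall Δ Y Z :=
  ⟨fun h _ hy => (h hy).2, fun h y hy => ⟨hY hy, h y hy⟩⟩

theorem polar_subset (Z : Set X) : P.polar Δ Z ⊆ P.f Δ := fun _ h => h.1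

theorem subset_polar_polar {Z : Set X} (hZ : Z ⊆ P.f Δ) :
    Z ⊆ P.polar Δ (P.polar Δ Z) :=
  (subset_polar_iff hZ).2 ((subset_polar_iff (polar_subset Z)).1 subset_rfl).symm

/-- The two polars of a set form a maximal edge configuration. -/
theorem edgeMaximal_polar {Z : Set X} (hZ : Z ⊆ P.f Δ) :
    P.EdgeMaximal Δ (P.polar Δ Z) (P.polar Δ (P.polar Δ Z)) := by
  refine ⟨((subset_polar_iff (polar_subset _)).1 subset_rfl).symm, ?_, ?_⟩
  · intro Y' hY' hlt h
    refine hlt.2 ((subset_polar_iff hY').2 fun y hy z hz => ?_)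
    exact h y hy z (subset_polar_polar hZ hz)
  · intro Z' hZ' hlt h
    exact hlt.2 ((subset_polar_iff hZ').2 h.symm)

theorem EdgeMaximal.symm {Y Z : Set X} (h : P.EdgeMaximal Δ Y Z) : P.EdgeMaximal Δ Z Y :=
  ⟨h.1.symm, fun Z' hZ' hlt hall => h.2.2 Z' hZ' hlt hall.symm,
    fun Y' hY' hlt hall => h.2.1 Y' hY' hlt hall.symm⟩

/-- Every node configuration of `dualHalf` can be enlarged to a maximal one. -/
theorem exists_nodeMaximal {d : ℕ} {f : Fin d → Set X} (hf : ∀ i, f i ⊆ P.f Δ)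
    (h : P.NodeForall Δ (Finset.univ.val.map f)) :
    ∃ f' : Fin d → Set X, (∀ i, f i ⊆ f' i) ∧ (∀ i, f' i ⊆ P.f Δ) ∧
      P.NodeMaximal Δ (Finset.univ.val.map f') := by
  classical
  set s : Set (Fin d → Set X) :=
    {f' | (∀ i, f' i ⊆ P.f Δ) ∧ P.NodeForall Δ (Finset.univ.val.map f')} with hs
  have hfin : s.Finite := by
    refine (Set.Finite.pi' (t := fun _ : Fin d => 𝒫 (P.f Δ))
      fun _ => (P.f_finite Δ).powerset).subset ?_
    intro f' hf' i
    exact hf'.1 i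
  obtain ⟨f', hle, hmax⟩ := hfin.exists_le_maximal (a := f) ⟨hf, h⟩
  refine ⟨f', hle, hmax.prop.1, hmax.prop.2, ?_⟩
  intro Y R hYR Y' hY' hlt hall
  obtain ⟨i, -, rfl⟩ : ∃ i ∈ (Finset.univ : Finset (Fin d)).val, f' i = Y := by
    rw [← Multiset.mem_map, hYR]
    exact Multiset.mem_cons_self Y R
  -- Enlarging the entry `i` of `f'` replaces the member `f' i` of the configuration.
  have hupd : Finset.univ.val.map (Function.update f' i Y') = Y' ::ₘ R := by
    have h1 : (Finset.univ : Finset (Fin d)).val =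
        i ::ₘ (Finset.univ.erase i).val := by
      rw [Finset.erase_val, Multiset.cons_erase]
      exact Finset.mem_univ i
    rw [h1, Multiset.map_cons] at hYR
    rw [h1, Multiset.map_cons, Function.update_self, ← (Multiset.cons_inj_right _).1 hYR]
    congr 1
    refine Multiset.map_congr rfl fun j hj => ?_
    rw [Function.update_of_ne (Finset.ne_of_mem_erase (Finset.mem_def.2 hj))]
  have hmem : Function.update f' i Y' ∈ s := by
    refine ⟨fun j => ?_, hupd ▸ hall⟩
    by_cases hj : j = i
    · subst hj
      rwa [Function.update_self]
    · rw [Function.update_of_ne hj]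
      exact hmax.prop.1 j
  have hge : f' ≤ Function.update f' i Y' := by
    intro j
    by_cases hj : j = i
    · subst hj
      rw [Function.update_self]
      exact hlt.1
    · rw [Function.update_of_ne hj]
  have h2 := hmax.le_of_ge hmem hge i
  rw [Function.update_self] at h2
  exact hlt.2 h2

end Problem

theorem OutputMap.tuple_mem {F : OutputMap 𝒞 X} {P : Problem X} {Δ : ℕ} (hF : F.Solves P Δ)
    (N : Network 𝒞) (v : Fin n) (i) : F.tuple N v i ∈ P.f Δ :=
  hF.mem_f _ _ _ _

/-! ### Simplifying and undoing the derived problems -/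

theorem EdgeSolvable.half' {P : Problem X} {𝒢 : Set (LabeledGraph Λ n)} {S : Finset ℕ+} {Δ : ℕ}
    (ht : 1 ≤ t) (h : EdgeSolvable P.half (withIds 𝒢 S) Δ t) :
    EdgeSolvable P.half' (withIds 𝒢 S) Δ t := by
  obtain ⟨F, hinv, hsol⟩ := h
  -- At each edge, the pair `(Y, Z)` is enlarged to a maximal pair of polars.
  set F' := F.edgeMap (fun _ Z => P.polar Δ Z) (fun _ Z => P.polar Δ (P.polar Δ Z)) with hF'
  have hf : ∀ N v u h, F N v u h ⊆ P.f Δ := hsol.mem_f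
  have hforall : ∀ N v u h, P.EdgeForall Δ (F N v u h) (F N u v (SimpleGraph.Adj.symm h)) :=
    fun N v u h => (Problem.mem_half_g.1 (hsol.mem_g N v u h)).2.2
  have hmem : ∀ N v u h, F' N v u h ⊆ P.f Δ := by
    intro N v u h
    rcases F.edgeMap_pair (φ := fun _ Z => P.polar Δ Z)
      (ψ := fun _ Z => P.polar Δ (P.polar Δ Z)) N.mem.2.1 h with h1 | h1
    · rw [hF', h1.1]; exact Problem.polar_subset _
    · rw [hF', h1.2]; exact Problem.polar_subset _
  have hmono : ∀ N v u h, F N v u h ⊆ F' N v u h := by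
    intro N v u h
    rcases F.edgeMap_pair (φ := fun _ Z => P.polar Δ Z)
      (ψ := fun _ Z => P.polar Δ (P.polar Δ Z)) N.mem.2.1 h with h1 | h1
    · rw [hF', h1.1]; exact (Problem.subset_polar_iff (hf N v u h)).2 (hforall N v u h)
    · rw [hF', h1.2]; exact Problem.subset_polar_polar (hf N v u h)
  refine ⟨F', hinv.edgeMap ht _ _, hmem, fun N v u h => ?_, fun N v => ?_⟩
  · refine (Problem.mem_powerProblem_g fun _ _ h => h.symm).2
      ⟨hmem N v u h, hmem N u v h.symm, ?_⟩
    rcases F.edgeMap_pair (φ := fun _ Z => P.polar Δ Z)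
      (ψ := fun _ Z => P.polar Δ (P.polar Δ Z)) N.mem.2.1 h with h1 | h1
    · rw [hF', h1.1, h1.2]
      exact Problem.edgeMaximal_polar (hf N u v h.symm)
    · rw [hF', h1.1, h1.2]
      exact (Problem.edgeMaximal_polar (hf N v u h)).symm
  · obtain ⟨h1, h2, h3⟩ := hsol.mem_h N v
    rw [OutputMap.config, Multiset.card_map] at h1
    refine ⟨by rwa [OutputMap.config, Multiset.card_map], ?_, Problem.NodeExists.mono h3
      fun i => hmono N v _ _⟩
    intro Y hY
    obtain ⟨i, -, rfl⟩ := Multiset.mem_map.1 hY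
    exact hmem N v _ _

theorem NodeSolvable.dualHalf' {Q : Problem X} {Δ : ℕ} (h : NodeSolvable Q.dualHalf 𝒞 Δ t) :
    NodeSolvable Q.dualHalf' 𝒞 Δ t := by
  classical
  obtain ⟨F, hinv, hsol⟩ := h
  have hex : ∀ (d : ℕ) (f : Fin d → Set X), ∃ f' : Fin d → Set X,
      (∀ i, f i ⊆ Q.f Δ) → Q.NodeForall Δ (Finset.univ.val.map f) →
      (∀ i, f i ⊆ f' i) ∧ (∀ i, f' i ⊆ Q.f Δ) ∧ Q.NodeMaximal Δ (Finset.univ.val.map f') := by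
    intro d f
    by_cases h : (∀ i, f i ⊆ Q.f Δ) ∧ Q.NodeForall Δ (Finset.univ.val.map f)
    · obtain ⟨f', hf'⟩ := Problem.exists_nodeMaximal h.1 h.2
      exact ⟨f', fun _ _ => hf'⟩
    · exact ⟨f, fun h1 h2 => (h ⟨h1, h2⟩).elim⟩
  choose sel hsel using hex
  have hsel' : ∀ (N : Network 𝒞) (v : Fin n), _ := fun N v =>
    hsel _ (F.tuple N v) (OutputMap.tuple_mem hsol N v) (hsol.mem_h N v).2.2
  have hmem : ∀ N v u h, F.portMap sel N v u h ⊆ Q.f Δ := fun N v u h => (hsel' N v).2.1 _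
  have hmono : ∀ N v u h, F N v u h ⊆ F.portMap sel N v u h := fun N v u h => by
    rw [← F.tuple_ports N h]
    exact (hsel' N v).1 _
  refine ⟨F.portMap sel, hinv.portMap sel, hmem, fun N v u h => ?_, fun N v => ?_⟩
  · obtain ⟨-, -, y, hy, z, hz, hyz⟩ := Problem.mem_dualHalf_g.1 (hsol.mem_g N v u h)
    exact Problem.mem_dualHalf'_g.2 ⟨hmem N v u h, hmem N u v h.symm,
      y, hmono N v u h hy, z, hmono N u v h.symm hz, hyz⟩
  · have h1 := (hsol.mem_h N v).1
    rw [OutputMap.config_portMap]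
    rw [OutputMap.config, Multiset.card_map] at h1
    refine ⟨by rwa [Multiset.card_map], ?_, (hsel' N v).2.2⟩
    intro Y hY
    obtain ⟨i, -, rfl⟩ := Multiset.mem_map.1 hY
    exact (hsel' N v).2.1 i

/-- Both endpoints of an edge know the two sets output there, and agree on a compatible choice of
elements. -/
theorem NodeSolvable.edgeSolvable_of_dualHalf {Q : Problem X} {𝒢 : Set (LabeledGraph Λ n)}
    {S : Finset ℕ+} {Δ : ℕ} (ht : 1 ≤ t)
    (h : NodeSolvable Q.dualHalf (withIds 𝒢 S) Δ (t - 1)) :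
    EdgeSolvable Q (withIds 𝒢 S) Δ t := by
  classical
  obtain ⟨F, hinv, hsol⟩ := h
  rcases isEmpty_or_nonempty X with hX | hX
  · -- Without labels there are no edges.
    have hno : ∀ (N : Network (withIds 𝒢 S)) (v u : Fin n), ¬ N.G.graph.Adj v u := by
      intro N v u h
      obtain ⟨-, -, ⟨y, -⟩⟩ := Problem.mem_dualHalf_g.1 (hsol.mem_g N v u h)
      exact hX.elim y
    refine ⟨fun N v u h => (hno N v u h).elim, fun M N v u w x h => (hno M v u h).elim,
      fun N v u h => (hno N v u h).elim, fun N v u h => (hno N v u h).elim, fun N v => ?_⟩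
    exact (Problem.nodeForall_map_iff Q Δ).1 (hsol.mem_h N v).2.2 _
      fun i => (hno N v _ ((N.ports v).symm i).2).elim
  have hex : ∀ Y Z : Set X, ∃ y z, Q.EdgeExists Δ Y Z → y ∈ Y ∧ z ∈ Z ∧ s(y, z) ∈ Q.g Δ := by
    intro Y Z
    by_cases h : Q.EdgeExists Δ Y Z
    · obtain ⟨y, hy, z, hz, hyz⟩ := h
      exact ⟨y, z, fun _ => ⟨hy, hz, hyz⟩⟩
    · exact ⟨Classical.arbitrary X, Classical.arbitrary X, fun h' => (h h').elim⟩
  choose φ ψ hφψ using hex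
  have hE : ∀ N v u h, Q.EdgeExists Δ (F N v u h) (F N u v (SimpleGraph.Adj.symm h)) :=
    fun N v u h => (Problem.mem_dualHalf_g.1 (hsol.mem_g N v u h)).2.2
  have hmem : ∀ N v u h, F.edgeMap φ ψ N v u h ∈ F N v u h := by
    intro N v u h
    rcases F.edgeMap_pair (φ := φ) (ψ := ψ) N.mem.2.1 h with h1 | h1
    · rw [h1.1]; exact (hφψ _ _ (hE N v u h)).1
    · rw [h1.2]; exact (hφψ _ _ (hE N u v h.symm)).2.1
  refine ⟨F.edgeMap φ ψ, (hinv.edgeInvariant ht).edgeMap ht φ ψ,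
    fun N v u h => hsol.mem_f N v u h (hmem N v u h), fun N v u h => ?_, fun N v => ?_⟩
  · rcases F.edgeMap_pair (φ := φ) (ψ := ψ) N.mem.2.1 h with h1 | h1
    · rw [h1.1, h1.2]; exact (hφψ _ _ (hE N v u h)).2.2
    · rw [h1.1, h1.2, Sym2.eq_swap]; exact (hφψ _ _ (hE N u v h.symm)).2.2
  · exact (Problem.nodeForall_map_iff Q Δ).1 (hsol.mem_h N v).2.2 _ fun i => hmem N v _ _

/-- A node knows the sets output at all its edges, and chooses a compatible tuple of elements. -/
theorem EdgeSolvable.nodeSolvable_of_half {P : Problem X} {Δ : ℕ} (ht : 1 ≤ t)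
    (h : EdgeSolvable P.half 𝒞 Δ t) : NodeSolvable P 𝒞 Δ t := by
  classical
  obtain ⟨F, hinv, hsol⟩ := h
  have hnd : ∀ (N : Network 𝒞) (v : Fin n), ∃ c : Fin _ → X,
      (∀ i, c i ∈ F.tuple N v i) ∧ Finset.univ.val.map c ∈ P.h Δ := fun N v =>
    (Problem.nodeExists_map_iff P Δ).1 (hsol.mem_h N v).2.2
  rcases isEmpty_or_nonempty X with hX | hX
  · -- Without labels there are no edges.
    have hno : ∀ (N : Network 𝒞) (v u : Fin n), ¬ N.G.graph.Adj v u := by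
      intro N v u h
      obtain ⟨c, -⟩ := hnd N v
      exact hX.elim (c (N.ports v ⟨u, h⟩))
    refine ⟨fun N v u h => (hno N v u h).elim, fun M N v w σ τ _ _ u h => (hno M v u h).elim,
      fun N v u h => (hno N v u h).elim, fun N v u h => (hno N v u h).elim, fun N v => ?_⟩
    obtain ⟨c, -, hc⟩ := hnd N v
    have heq : ∀ c' : Fin _ → X, c' = c := fun c' => funext fun i => hX.elim (c i)
    rw [OutputMap.config, heq (OutputMap.tuple _ N v)]
    exact hc
  have hex : ∀ (d : ℕ) (f : Fin d → Set X), ∃ c : Fin d → X,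
      (∃ c : Fin d → X, (∀ i, c i ∈ f i) ∧ Finset.univ.val.map c ∈ P.h Δ) →
      (∀ i, c i ∈ f i) ∧ Finset.univ.val.map c ∈ P.h Δ := by
    intro d f
    by_cases h : ∃ c : Fin d → X, (∀ i, c i ∈ f i) ∧ Finset.univ.val.map c ∈ P.h Δ
    · obtain ⟨c, hc⟩ := h
      exact ⟨c, fun _ => hc⟩
    · exact ⟨fun _ => Classical.arbitrary X, fun h' => (h h').elim⟩
  choose sel hsel using hex
  have hsel' : ∀ (N : Network 𝒞) (v : Fin n), _ := fun N v => hsel _ (F.tuple N v) (hnd N v)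
  have hmem : ∀ N v u h, F.portMap sel N v u h ∈ F N v u h := by
    intro N v u h
    rw [← F.tuple_ports N h]
    exact (hsel' N v).1 _
  refine ⟨F.portMap sel, (hinv.nodeInvariant ht).portMap sel,
    fun N v u h => hsol.mem_f N v u h (hmem N v u h), fun N v u h => ?_, fun N v => ?_⟩
  · exact (Problem.mem_half_g.1 (hsol.mem_g N v u h)).2.2 _ (hmem N v u h) _ (hmem N u v h.symm)
  · rw [OutputMap.config_portMap]
    exact (hsel' N v).2

end LocalSpeedup

namespace LocalSpeedup

/-! ### Amalgamation of networks along a common part -/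

/-- Linear orders on sets that pairwise meet in a common core, on which the orders agree, have a
common extension to an injective ranking of all nodes. -/
theorem exists_common_ranking {n : ℕ} {ι : Type*} [LinearOrder ι] {B₀ : Set (Fin n)}
    {B : ι → Set (Fin n)} {r : ι → Fin n → ℕ+}
    (hB : ∀ i j, i ≠ j → B i ∩ B j ⊆ B₀)
    (hr : ∀ i j, ∀ a ∈ B₀, ∀ b ∈ B₀, r i a < r i b ↔ r j a < r j b)
    (hinj : ∀ i, Set.InjOn (r i) (B i)) :
    ∃ k : Fin n → ℕ, Function.Injective k ∧
      ∀ i, ∀ a ∈ B i, ∀ b ∈ B i, k a < k b ↔ r i a < r i b := by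
  classical
  rcases isEmpty_or_nonempty ι with hι | hι
  · exact ⟨fun v => v, Fin.val_injective, fun i => hι.elim i⟩
  have hidx : ∀ a, ∃ i, (∃ j, a ∈ B j) → a ∈ B i := by
    intro a
    by_cases h : ∃ j, a ∈ B j
    · obtain ⟨j, hj⟩ := h
      exact ⟨j, fun _ => hj⟩
    · exact ⟨Classical.arbitrary ι, fun h' => (h h').elim⟩
  choose idx hidx using hidx
  -- Nodes are ordered first by their position relative to the core, where the elements of the
  -- core get odd positions. Nodes in the same gap of the core are ordered by the set they belong
  -- to, and those in the same set by the order given there.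
  set below : ι → Fin n → Finset (Fin n) :=
    fun i a => Finset.univ.filter fun c => c ∈ B₀ ∧ r i c < r i a with hbelow
  set pos : ι → Fin n → ℕ := fun i a => 2 * (below i a).card + if a ∈ B₀ then 1 else 0 with hpos
  set key : Fin n → ℕ ×ₗ (ι ×ₗ (ℕ+ ×ₗ Fin n)) :=
    fun a => toLex (pos (idx a) a, toLex (idx a, toLex (r (idx a) a, a))) with hkey
  have hkinj : Function.Injective key := by
    intro a b hab
    simp only [hkey, EmbeddingLike.apply_eq_iff_eq, Prod.mk.injEq] at hab
    exact hab.2.2.2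
  have hidx_eq : ∀ i, ∀ a ∈ B i, a ∉ B₀ → idx a = i := by
    intro i a ha ha₀
    by_contra hne
    exact ha₀ (hB _ _ hne ⟨hidx a ⟨i, ha⟩, ha⟩)
  have hpos_eq : ∀ i, ∀ a ∈ B i, pos (idx a) a = pos i a := by
    intro i a ha
    by_cases ha₀ : a ∈ B₀
    · have : below (idx a) a = below i a := by
        ext c
        simp only [hbelow, Finset.mem_filter, Finset.mem_univ, true_and]
        exact and_congr_right fun hc => hr _ _ c hc a ha₀
      simp only [hpos, this]
    · rw [hidx_eq i a ha ha₀]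
  have hlt : ∀ i, ∀ a ∈ B i, ∀ b ∈ B i, r i a < r i b → key a < key b := by
    intro i a ha b hb hab
    have hsub : below i a ⊆ below i b := by
      intro c hc
      simp only [hbelow, Finset.mem_filter, Finset.mem_univ, true_and] at hc ⊢
      exact ⟨hc.1, hc.2.trans hab⟩
    have hle := Finset.card_le_card hsub
    simp only [hkey, Prod.Lex.toLex_lt_toLex, hpos_eq i a ha, hpos_eq i b hb]
    by_cases ha₀ : a ∈ B₀
    · left
      have hss : below i a ⊂ below i b := by
        refine Finset.ssubset_iff_of_subset hsub |>.2 ⟨a, ?_, ?_⟩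
        · simp [hbelow, ha₀, hab]
        · simp [hbelow]
      have := Finset.card_lt_card hss
      simp only [hpos, ha₀, if_true]
      omega
    · by_cases hb₀ : b ∈ B₀
      · left
        simp only [hpos, ha₀, hb₀, if_true, if_false]
        omega
      · rw [hidx_eq i a ha ha₀, hidx_eq i b hb hb₀]
        have hp : pos i a ≤ pos i b := by
          simp only [hpos, ha₀, hb₀, if_false]
          omega
        rcases hp.lt_or_eq with hp | hp
        · exact Or.inl hp
        · exact Or.inr ⟨hp, Or.inr ⟨rfl, Or.inl hab⟩⟩
  have hlt_iff : ∀ i, ∀ a ∈ B i, ∀ b ∈ B i, key a < key b ↔ r i a < r i b := by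
    intro i a ha b hb
    refine ⟨fun h => ?_, hlt i a ha b hb⟩
    by_contra hnot
    rcases (not_lt.1 hnot).lt_or_eq with h' | h'
    · exact (hlt i b hb a ha h').asymm h
    · rw [hinj i hb ha h'] at h
      exact lt_irrefl _ h
  have hmono : ∀ a b, key a < key b →
      (Finset.univ.filter fun c => key c < key a).card <
        (Finset.univ.filter fun c => key c < key b).card := by
    intro a b hab
    refine Finset.card_lt_card ((Finset.ssubset_iff_of_subset ?_).2 ⟨a, by simpa using hab, by simp⟩)
    intro c hc
    simp only [Finset.mem_filter, Finset.mem_univ, true_and] at hc ⊢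
    exact hc.trans hab
  have hmono_iff : ∀ a b, (Finset.univ.filter fun c => key c < key a).card <
      (Finset.univ.filter fun c => key c < key b).card ↔ key a < key b := by
    intro a b
    refine ⟨fun h => ?_, hmono a b⟩
    by_contra hnot
    rcases (not_lt.1 hnot).lt_or_eq with h' | h'
    · exact (hmono b a h').asymm h
    · rw [h'] at h
      exact lt_irrefl _ h
  refine ⟨fun a => (Finset.univ.filter fun c => key c < key a).card, fun a b hab => ?_,
    fun i a ha b hb => (hmono_iff a b).trans (hlt_iff i a ha b hb)⟩
  by_contra hne
  rcases lt_or_gt_of_ne (hkinj.ne hne) with h | h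
  · exact (hmono a b h).ne hab
  · exact (hmono b a h).ne hab.symm

/-- The identifiers in use can be permuted so as to induce any given ranking of the nodes. -/
theorem exists_ident_of_ranking {n : ℕ} {S : Finset ℕ+} {ident : Fin n → ℕ+}
    (hinj : Function.Injective ident) (hS : ∀ v, ident v ∈ S) {k : Fin n → ℕ}
    (hk : Function.Injective k) :
    ∃ ident' : Fin n → ℕ+, Function.Injective ident' ∧ (∀ v, ident' v ∈ S) ∧
      ∀ a b, ident' a < ident' b ↔ k a < k b := by
  classical
  set T : Finset ℕ+ := Finset.univ.image ident with hT
  have hTc : T.card = n := by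
    rw [hT, Finset.card_image_of_injective _ hinj, Finset.card_univ, Fintype.card_fin]
  set R : Finset ℕ := Finset.univ.image k with hR
  have hRc : R.card = n := by
    rw [hR, Finset.card_image_of_injective _ hk, Finset.card_univ, Fintype.card_fin]
  have hkR : ∀ v, k v ∈ R := fun v => Finset.mem_image_of_mem _ (Finset.mem_univ v)
  set pos : Fin n → Fin n := fun v => (R.orderIsoOfFin hRc).symm ⟨k v, hkR v⟩ with hpos
  have hlt : ∀ a b, T.orderEmbOfFin hTc (pos a) < T.orderEmbOfFin hTc (pos b) ↔ k a < k b := by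
    intro a b
    rw [OrderEmbedding.lt_iff_lt, hpos]
    simp
  refine ⟨fun v => T.orderEmbOfFin hTc (pos v), fun a b hab => ?_, fun v => ?_, hlt⟩
  · by_contra hne
    rcases lt_or_gt_of_ne (hk.ne hne) with h | h
    · exact ((hlt a b).2 h).ne hab
    · exact ((hlt b a).2 h).ne hab.symm
  · obtain ⟨w, -, hw⟩ := Finset.mem_image.1 (T.orderEmbOfFin_mem hTc (pos v))
    change T.orderEmbOfFin hTc (pos v) ∈ S
    exact hw ▸ hS w

variable {Λ : Type*} {n : ℕ} {𝒢 : Set (LabeledGraph Λ n)} {S : Finset ℕ+} {X : Type*} {t : ℕ}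

/-- If neighborhoods in networks `M i` all contain a common part, and the underlying information
is jointly realized in a graph `H` so that the images meet only in this common part, then `H` has
identifiers and port numbers that realize the port numbers and the orders of the identifiers of all
these neighborhoods. -/
theorem exists_amalgam {M₀ : Network (withIds 𝒢 S)} {H : LabeledGraph Λ n} (hH : H ∈ 𝒢)
    {ι : Type*} [LinearOrder ι] {M : ι → Network (withIds 𝒢 S)} {A₀ B₀ : Set (Fin n)}
    {A' A B : ι → Set (Fin n)} {σ : Fin n → Fin n} {τ : Fin n → Fin n → Fin n}
    {σ' ρ : ι → Fin n → Fin n} {τ' κ : ι → Fin n → Fin n → Fin n}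
    (h₀ : IsInfoIso M₀.G A₀ H B₀ σ τ)
    (h' : ∀ i, IsOrderIso M₀ A₀ (M i) (A' i) (σ' i) (τ' i)) (hA : ∀ i, A' i ⊆ A i)
    (hρ : ∀ i, IsInfoIso (M i).G (A i) H (B i) (ρ i) (κ i))
    (hext : ∀ i, Extends M₀.G A₀ (σ' i) (τ' i) (ρ i) (κ i) σ τ)
    (hB : ∀ i j, i ≠ j → B i ∩ B j ⊆ B₀) :
    ∃ (ident : Fin n → ℕ+) (hmem : (H, ident) ∈ withIds 𝒢 S) (q : Ports H),
      ∀ i, IsOrderIso (M i) (A i) ⟨H, ident, hmem, q⟩ (B i) (ρ i) (κ i) := by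
  classical
  have : Nonempty (Fin n) := H.connected.nonempty
  have hσ'A : ∀ i, ∀ c ∈ A₀, σ' i c ∈ A i := fun i c hc => hA i ((h' i).info.nodes.mapsTo hc)
  -- The rank of a node of `H` in the order carried over from `M i`.
  set r : ι → Fin n → ℕ+ := fun i b => (M i).ident (Function.invFunOn (ρ i) (A i) b) with hrdef
  have hr : ∀ i, ∀ a ∈ A i, r i (ρ i a) = (M i).ident a := fun i a ha =>
    congrArg (M i).ident ((hρ i).nodes.injOn.leftInvOn_invFunOn ha)
  have hr₀ : ∀ i, ∀ a ∈ A₀, ∀ b ∈ A₀, r i (σ a) < r i (σ b) ↔ M₀.ident a < M₀.ident b := by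
    intro i a ha b hb
    rw [← (hext i a ha).1, ← (hext i b hb).1, hr i _ (hσ'A i a ha), hr i _ (hσ'A i b hb)]
    exact (h' i).lt_iff a ha b hb
  obtain ⟨k, hk, hkr⟩ := exists_common_ranking (B₀ := B₀) (B := B) (r := r)
    hB
    (by
      intro i j b hb c hc
      obtain ⟨a, ha, rfl⟩ := h₀.nodes.surjOn hb
      obtain ⟨a', ha', rfl⟩ := h₀.nodes.surjOn hc
      rw [hr₀ i a ha a' ha', hr₀ j a ha a' ha'])
    (by
      intro i b hb c hc hbc
      obtain ⟨a, ha, rfl⟩ := (hρ i).nodes.surjOn hb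
      obtain ⟨a', ha', rfl⟩ := (hρ i).nodes.surjOn hc
      rw [hr i a ha, hr i a' ha'] at hbc
      rw [(M i).mem.2.1 hbc])
  obtain ⟨ident, hinj, hS, hident⟩ := exists_ident_of_ranking M₀.mem.2.1 M₀.mem.2.2 hk
  have hports : ∀ a : Fin n, ∃ e : H.graph.neighborSet a ≃ Fin (Nat.card (H.graph.neighborSet a)),
      ∀ i, ∀ a' ∈ A i, ρ i a' = a → ∀ (b : Fin n) (hb : (M i).G.graph.Adj a' b)
        (hb' : H.graph.Adj a (κ i a' b)), (e ⟨κ i a' b, hb'⟩ : ℕ) = (M i).ports a' ⟨b, hb⟩ := by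
    intro a
    by_cases hex : ∃ i, a ∈ B i
    swap
    · refine ⟨Finite.equivFin _, fun i a' ha' haa => ?_⟩
      exact (hex ⟨i, haa ▸ (hρ i).nodes.mapsTo ha'⟩).elim
    obtain ⟨i, hi⟩ := hex
    obtain ⟨a₁, ha₁, rfl⟩ := (hρ i).nodes.surjOn hi
    have hbij := (hρ i).edges a₁ ha₁
    set e := (hbij.equiv.symm.trans ((M i).ports a₁)).trans
      (finCongr ((hρ i).card_neighborSet ha₁)) with he
    have he_eq : ∀ (b : Fin n) (hb : (M i).G.graph.Adj a₁ b)
        (hb' : H.graph.Adj (ρ i a₁) (κ i a₁ b)),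
        (e ⟨κ i a₁ b, hb'⟩ : ℕ) = (M i).ports a₁ ⟨b, hb⟩ := by
      intro b hb hb'
      have h1 : (hbij.equiv : _ ≃ _) ⟨b, hb⟩ = ⟨κ i a₁ b, hb'⟩ := rfl
      have h2 := hbij.equiv.symm_apply_apply ⟨b, hb⟩
      rw [h1] at h2
      exact congrArg (fun x => ((M i).ports a₁ x : ℕ)) h2
    refine ⟨e, fun j a₂ ha₂ haa b hb hb' => ?_⟩
    by_cases hij : i = j
    · subst hij
      obtain rfl := (hρ i).nodes.injOn ha₂ ha₁ haa
      exact he_eq b hb hb'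
    · -- A node in two of the images lies in the common part, where all port numbers agree.
      obtain ⟨c, hc, hca⟩ := h₀.nodes.surjOn
        (hB i j hij ⟨hi, haa ▸ (hρ j).nodes.mapsTo ha₂⟩)
      have hc₁ : σ' i c = a₁ := (hρ i).nodes.injOn (hσ'A i c hc) ha₁ ((hext i c hc).1.trans hca)
      have hc₂ : σ' j c = a₂ := (hρ j).nodes.injOn (hσ'A j c hc) ha₂
        ((hext j c hc).1.trans (hca.trans haa.symm))
      subst hc₁ hc₂
      obtain ⟨d, hd, rfl⟩ := ((h' j).info.edges c hc).surjOn hb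
      have hd₁ : (M i).G.graph.Adj (σ' i c) (τ' i c d) := (h' i).info.adj hc hd
      rw [(h' j).port_eq c hc d hd hb, ← (h' i).port_eq c hc d hd hd₁,
        ← he_eq _ hd₁ ((hρ i).adj ha₁ hd₁)]
      congr 3
      exact ((hext j c hc).2 d hd).trans ((hext i c hc).2 d hd).symm
  choose q hq using hports
  refine ⟨ident, ⟨hH, hinj, hS⟩, q, fun i => ⟨hρ i, ?_, ?_⟩⟩
  · intro a ha b hab hab'
    exact hq (ρ i a) i a ha rfl b hab hab'
  · intro a ha b hb
    have h1 := hkr i _ ((hρ i).nodes.mapsTo ha) _ ((hρ i).nodes.mapsTo hb)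
    rw [hr i a ha, hr i b hb] at h1
    exact (hident _ _).trans h1

/-! ### Gaining half a round -/

/-- The set of outputs of `F` at `(v, e)` that are possible given `N^t(e)`, over all extensions of
`N^t(e)` to `N^t(v)`. -/
def OutputMap.edgeHull (t : ℕ) (F : OutputMap (withIds 𝒢 S) X) : OutputMap (withIds 𝒢 S) (Set X) :=
  fun N v u _ => {y | ∃ (M : Network (withIds 𝒢 S)) (w x : Fin n) (hwx : M.G.graph.Adj w x)
    (σ : Fin n → Fin n) (τ : Fin n → Fin n → Fin n),
    IsOrderIso N (N.G.edgeBall t v u) M (M.G.edgeBall t w x) σ τ ∧ σ v = w ∧ σ u = x ∧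
      F M w x hwx = y}

/-- The set of outputs of `F` at `(v, e)` that are possible given `N^{t-1}(v)`, over all extensions
of `N^{t-1}(v)` to `N^t(e)`. -/
def OutputMap.nodeHull (t : ℕ) (F : OutputMap (withIds 𝒢 S) X) : OutputMap (withIds 𝒢 S) (Set X) :=
  fun N v u _ => {y | ∃ (M : Network (withIds 𝒢 S)) (w : Fin n) (σ : Fin n → Fin n)
    (τ : Fin n → Fin n → Fin n) (hw : M.G.graph.Adj w (τ v u)),
    IsOrderIso N (N.G.ball (t - 1) v) M (M.G.ball (t - 1) w) σ τ ∧ σ v = w ∧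
      F M w (τ v u) hw = y}

theorem OutputMap.edgeInvariant_edgeHull (ht : 1 ≤ t) (F : OutputMap (withIds 𝒢 S) X) :
    EdgeInvariant t (F.edgeHull t) := by
  rintro M N v u w x h h' σ τ hiso rfl rfl
  ext y
  constructor
  · rintro ⟨K, _, _, hK, ρ, κ, hρ, rfl, rfl, rfl⟩
    exact ⟨K, _, _, hK, _, _, hiso.trans hρ, rfl, rfl, rfl⟩
  · rintro ⟨K, _, _, hK, ρ, κ, hρ, rfl, rfl, rfl⟩
    obtain ⟨σ', τ', hs, hl, -⟩ := hiso.exists_symm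
    exact ⟨K, _, _, hK, _, _, hs.trans hρ,
      congrArg ρ (hl v (M.G.left_mem_edgeBall ht h)),
      congrArg ρ (hl u (M.G.right_mem_edgeBall ht h)), rfl⟩

theorem OutputMap.nodeInvariant_nodeHull (F : OutputMap (withIds 𝒢 S) X) :
    NodeInvariant (t - 1) (F.nodeHull t) := by
  rintro M N v w σ τ hiso rfl u h h'
  ext y
  constructor
  · rintro ⟨K, _, ρ, κ, hK, hρ, rfl, rfl⟩
    exact ⟨K, _, _, _, hK, hiso.trans hρ, rfl, rfl⟩
  · rintro ⟨K, _, ρ, κ, hK, hρ, rfl, rfl⟩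
    obtain ⟨σ', τ', hs, hl, hl'⟩ := hiso.exists_symm
    have hv := M.G.self_mem_ball (t - 1) v
    have h1 : κ (σ' (σ v)) (τ' (σ v) (τ v u)) = κ v u := by
      rw [hl v hv, hl' v hv u h]
    refine ⟨K, _, _, _, ?_, hs.trans hρ, congrArg ρ (hl v hv), ?_⟩
    · rw [h1]
      exact hK
    · congr 1

theorem NodeSolvable.edgeSolvable_half {P : Problem X} {Δ : ℕ} (ht : 1 ≤ t)
    (hind : EdgeIndependent 𝒢 t) (h : NodeSolvable P (withIds 𝒢 S) Δ t) :
    EdgeSolvable P.half (withIds 𝒢 S) Δ t := by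
  obtain ⟨F, hinv, hsol⟩ := h
  have hself : ∀ N v u h, F N v u h ∈ F.edgeHull t N v u h := fun N v u h =>
    ⟨N, v, u, h, _, _, IsOrderIso.refl N _, rfl, rfl, rfl⟩
  have hf : ∀ N v u h, F.edgeHull t N v u h ⊆ P.f Δ := by
    rintro N v u h _ ⟨M, w, x, hM, -, -, -, -, -, rfl⟩
    exact hsol.mem_f M w x hM
  refine ⟨F.edgeHull t, F.edgeInvariant_edgeHull ht, hf, fun N v u h => ?_, fun N v => ?_⟩
  · refine Problem.mem_half_g.2 ⟨hf N v u h, hf N u v h.symm, ?_⟩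
    rintro _ ⟨M₁, v₁, u₁, hM₁, σ₁, τ₁, h₁, hv₁, hu₁, rfl⟩
      _ ⟨M₂, u₂, v₂, hM₂, σ₂, τ₂, h₂, hu₂, hv₂, rfl⟩
    -- Both outputs occur at one edge of a network, by independence.
    rw [N.G.edgeBall_comm, M₁.G.edgeBall_comm] at h₁
    obtain ⟨H, hH, x, w, hxw, σ, τ, hσ, hx, hw, ⟨ρ₁, κ₁, hρ₁, hext₁⟩, ρ₂, κ₂, hρ₂, hext₂⟩ :=
      hind N.G N.mem.1 u v h.symm M₁.G M₁.mem.1 u₁ v₁ hM₁.symm σ₁ τ₁ h₁.info hu₁ hv₁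
        M₂.G M₂.mem.1 u₂ v₂ hM₂ σ₂ τ₂ h₂.info hu₂ hv₂
    obtain ⟨ident, hmem, q, hq⟩ := exists_amalgam (M₀ := N) hH (ι := Bool)
      (M := fun i => if i then M₁ else M₂)
      (A' := fun i => if i then M₁.G.edgeBall t u₁ v₁ else M₂.G.edgeBall t u₂ v₂)
      (A := fun i => if i then M₁.G.ball t v₁ else M₂.G.ball t u₂)
      (B := fun i => if i then H.ball t w else H.ball t x)
      (σ' := fun i => if i then σ₁ else σ₂) (τ' := fun i => if i then τ₁ else τ₂)
      (ρ := fun i => if i then ρ₁ else ρ₂) (κ := fun i => if i then κ₁ else κ₂) hσ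
      (Bool.forall_bool.2 ⟨h₂, h₁⟩)
      (Bool.forall_bool.2 ⟨Set.inter_subset_left, Set.inter_subset_right⟩)
      (Bool.forall_bool.2 ⟨hρ₂, hρ₁⟩) (Bool.forall_bool.2 ⟨hext₂, hext₁⟩)
      (by
        rintro (_ | _) (_ | _) hne
        · exact (hne rfl).elim
        · exact subset_rfl
        · exact (Set.inter_comm _ _).subset
        · exact (hne rfl).elim)
    have hq₁ : IsOrderIso M₁ (M₁.G.ball t v₁) ⟨H, ident, hmem, q⟩ (H.ball t w) ρ₁ κ₁ := hq true
    have hq₂ : IsOrderIso M₂ (M₂.G.ball t u₂) ⟨H, ident, hmem, q⟩ (H.ball t x) ρ₂ κ₂ := hq false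
    have hue := N.G.left_mem_edgeBall ht h.symm
    have hve := N.G.right_mem_edgeBall ht h.symm
    have hκ₁ : κ₁ v₁ u₁ = x := by
      have h3 := (hext₁ v hve).2 u h
      rwa [h₁.info.inner v hve u hue h, hσ.inner v hve u hue h, hv₁, hu₁, hx] at h3
    have hκ₂ : κ₂ u₂ v₂ = w := by
      have h3 := (hext₂ u hue).2 v h.symm
      rwa [h₂.info.inner u hue v hve h.symm, hσ.inner u hue v hve h.symm, hv₂, hu₂, hw] at h3
    have hw₁ : ρ₁ v₁ = w := by rw [← hv₁, (hext₁ v hve).1, hw]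
    have hx₂ : ρ₂ u₂ = x := by rw [← hu₂, (hext₂ u hue).1, hx]
    have e₁ := hinv M₁ ⟨H, ident, hmem, q⟩ v₁ w ρ₁ κ₁ hq₁ hw₁ u₁ hM₁ (hκ₁ ▸ hxw.symm)
    have e₂ := hinv M₂ ⟨H, ident, hmem, q⟩ u₂ x ρ₂ κ₂ hq₂ hx₂ v₂ hM₂ (hκ₂ ▸ hxw)
    rw [← e₁, ← e₂]
    have h4 := hsol.mem_g ⟨H, ident, hmem, q⟩ w x hxw.symm
    convert h4 using 3
  · have h1 := hsol.mem_h N v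
    have h2 := (P.h_card Δ _ h1)
    rw [OutputMap.config, Multiset.card_map] at h2
    refine ⟨by rwa [OutputMap.config, Multiset.card_map], ?_,
      (Problem.nodeExists_map_iff P Δ).2 ⟨F.tuple N v, fun i => hself N v _ _, h1⟩⟩
    intro Y hY
    obtain ⟨i, -, rfl⟩ := Multiset.mem_map.1 hY
    exact hf N v _ _

/-- The node configuration at `w`, computed through a bijection with the edges at another node. -/
theorem OutputMap.config_eq {F : OutputMap (withIds 𝒢 S) X} {M N : Network (withIds 𝒢 S)}
    {v w : Fin n} {f : Fin n → Fin n}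
    (hf : Set.BijOn f (M.G.graph.neighborSet v) (N.G.graph.neighborSet w))
    {c : Fin (Nat.card (M.G.graph.neighborSet v)) → X}
    (hc : ∀ (u : Fin n) (h : M.G.graph.Adj v u) (h' : N.G.graph.Adj w (f u)),
      F N w (f u) h' = c (M.ports v ⟨u, h⟩)) :
    F.config N w = Finset.univ.val.map c := by
  set e := ((M.ports v).symm.trans hf.equiv).trans (N.ports w) with he
  rw [OutputMap.config, ← Multiset.map_univ_val_equiv e, Multiset.map_map]
  refine Multiset.map_congr rfl fun i _ => ?_
  obtain ⟨⟨u, hu⟩, rfl⟩ := (M.ports v).surjective i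
  have h1 : e (M.ports v ⟨u, hu⟩) = N.ports w ⟨f u, hf.mapsTo hu⟩ := by
    simp only [he, Equiv.trans_apply, Equiv.symm_apply_apply]
    rfl
  rw [Function.comp_apply, h1]
  exact (F.tuple_ports N _).trans (hc u hu _)

theorem EdgeSolvable.nodeSolvable_dualHalf {Q : Problem X} {Δ : ℕ} (ht : 1 ≤ t)
    (hind : NodeIndependent 𝒢 t)
    (hgirth : ∀ G ∈ 𝒢, ((2 * t + 2 : ℕ) : ℕ∞) ≤ G.graph.egirth)
    (h : EdgeSolvable Q (withIds 𝒢 S) Δ t) :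
    NodeSolvable Q.dualHalf (withIds 𝒢 S) Δ (t - 1) := by
  classical
  obtain ⟨F, hinv, hsol⟩ := h
  have hself : ∀ N v u h, F N v u h ∈ F.nodeHull t N v u h := fun N v u h =>
    ⟨N, v, _, _, h, IsOrderIso.refl N _, rfl, rfl⟩
  have hf : ∀ N v u h, F.nodeHull t N v u h ⊆ Q.f Δ := by
    rintro N v u h _ ⟨M, w, σ, τ, hM, -, -, rfl⟩
    exact hsol.mem_f M w _ hM
  refine ⟨F.nodeHull t, F.nodeInvariant_nodeHull, hf, fun N v u h => ?_, fun N v => ?_⟩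
  · exact Problem.mem_dualHalf_g.2 ⟨hf N v u h, hf N u v h.symm, _, hself N v u h, _,
      hself N u v h.symm, hsol.mem_g N v u h⟩
  · have h2 := Q.h_card Δ _ (hsol.mem_h N v)
    rw [OutputMap.config, Multiset.card_map] at h2
    refine ⟨by rwa [OutputMap.config, Multiset.card_map], ?_,
      (Problem.nodeForall_map_iff Q Δ).2 fun c hc => ?_⟩
    · intro Y hY
      obtain ⟨i, -, rfl⟩ := Multiset.mem_map.1 hY
      exact hf N v _ _
    -- The chosen outputs occur at the edges of one node of a network, by independence.
    have hex : ∀ u, ∃ (M : Network (withIds 𝒢 S)) (w : Fin n) (σ : Fin n → Fin n)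
        (τ : Fin n → Fin n → Fin n), ∀ h : N.G.graph.Adj v u, ∃ hw : M.G.graph.Adj w (τ v u),
        IsOrderIso N (N.G.ball (t - 1) v) M (M.G.ball (t - 1) w) σ τ ∧ σ v = w ∧
          F M w (τ v u) hw = c (N.ports v ⟨u, h⟩) := by
      intro u
      by_cases h : N.G.graph.Adj v u
      · have h1 := hc (N.ports v ⟨u, h⟩)
        rw [OutputMap.tuple_ports] at h1
        obtain ⟨M, w, σ, τ, hw, h3⟩ := h1
        exact ⟨M, w, σ, τ, fun _ => ⟨hw, h3⟩⟩
      · exact ⟨N, v, id, fun _ => id, fun h' => (h h').elim⟩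
    choose K ctr σ' τ' hK using hex
    obtain ⟨H, hH, w, σ, τ, hσ, hw, hext⟩ := hind N.G N.mem.1 v (fun u => (K u).G) ctr σ' τ'
      fun u hu => by
        obtain ⟨-, h3, h4, -⟩ := hK u hu
        exact ⟨(K u).mem.1, h3.info, h4⟩
    choose ρ κ hρ hext using hext
    have hv := N.G.self_mem_ball (t - 1) v
    have hadj : ∀ u, N.G.graph.Adj v u → H.graph.Adj w (τ v u) := fun u hu =>
      hw ▸ hσ.adj hv hu
    obtain ⟨ident, hmem, q, hq⟩ := exists_amalgam (M₀ := N) hH (ι := {u // N.G.graph.Adj v u})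
      (M := fun u => K u) (A' := fun u => (K u).G.ball (t - 1) (ctr u))
      (A := fun u => (K u).G.edgeBall t (ctr u) (τ' u v u))
      (B := fun u => H.edgeBall t w (τ v u)) (σ' := fun u => σ' u) (τ' := fun u => τ' u)
      (ρ := fun u => ρ u u.2) (κ := fun u => κ u u.2) hσ
      (fun u => (hK u u.2).2.1)
      (fun u => (K u).G.ball_pred_subset_edgeBall ht (hK u u.2).1)
      (fun u => hρ u u.2) (fun u => hext u u.2)
      (fun u u' hne => H.edgeBall_inter_subset (hgirth H hH) (hadj u u.2) (hadj u' u'.2)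
        fun heq => hne (Subtype.ext ((hσ.edges v hv).injOn u.2 u'.2 heq)))
    have hbij : Set.BijOn (τ v) (N.G.graph.neighborSet v) (H.graph.neighborSet w) :=
      hw ▸ hσ.edges v hv
    rw [← OutputMap.config_eq (F := F) (M := N) (N := ⟨H, ident, hmem, q⟩) hbij fun u hu hu' => ?_]
    · exact hsol.mem_h ⟨H, ident, hmem, q⟩ w
    obtain ⟨hKu, h3, h4, h5⟩ := hK u hu
    rw [← h5]
    have h6 := hq ⟨u, hu⟩
    have h7 := (hext u hu v hv).1
    have h8 := (hext u hu v hv).2 u hu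
    rw [h4] at h7 h8
    refine hinv (K u) ⟨H, ident, hmem, q⟩ _ _ _ _ hKu hu' _ _ h6 (h7.trans hw) ?_
    rw [← h8]
    exact ((hρ u hu).inner _ ((K u).G.left_mem_edgeBall ht hKu) _
      ((K u).G.right_mem_edgeBall ht hKu) hKu).symm

/-- The simplified problem only strengthens the constraints. -/
theorem NodeSolvable.one_of_one' {P : Problem X} {𝒞 : Set (LabeledGraph Λ n × (Fin n → ℕ+))}
    {Δ : ℕ} (h : NodeSolvable P.one' 𝒞 Δ t) : NodeSolvable P.one 𝒞 Δ t := by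
  obtain ⟨F, hinv, hsol⟩ := h
  refine ⟨F, hinv, hsol.mem_f, fun N v u h => ?_, fun N v => ?_⟩
  · obtain ⟨h1, h2, y, hy, z, hz, hyz⟩ := Problem.mem_dualHalf'_g.1 (hsol.mem_g N v u h)
    obtain ⟨y', z', heq, hy', hz', hmax⟩ := hyz
    exact Problem.mem_dualHalf_g.2 ⟨h1, h2, y, hy, z, hz, y', z', heq, hy', hz', hmax.1⟩
  · obtain ⟨h1, h2, h3⟩ := hsol.mem_h N v
    exact ⟨h1, h2, h3.1⟩

end LocalSpeedup

theorem mainTheorem4 {O Λ : Type*} (P : Problem O) (n Δ t : ℕ) (ht : 1 ≤ t)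
    (𝒢 : Set (LabeledGraph Λ n))
    (hΔ : ∀ G ∈ 𝒢, G.maxDegree = Δ)
    (hindep : TIndependent 𝒢 t)
    (hgirth : ∀ G ∈ 𝒢, ((2 * t + 2 : ℕ) : ℕ∞) ≤ G.graph.egirth)
    (S : Finset ℕ+) (hS : 4 * Δ ^ (2 * t) ≤ S.card) :
    List.TFAE [
      OrderInvariantSolvable P (withIds 𝒢 S) Δ t,
      OrderInvariantSolvable P.one (withIds 𝒢 S) Δ (t - 1),
      OrderInvariantSolvable P.one' (withIds 𝒢 S) Δ (t - 1)] := by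
  simp only [orderInvariantSolvable_iff]
  tfae_have 1 → 3 := fun h =>
    (((h.edgeSolvable_half ht hindep.1).half' ht).nodeSolvable_dualHalf ht hindep.2
      hgirth).dualHalf'
  tfae_have 3 → 2 := NodeSolvable.one_of_one'
  tfae_have 2 → 1 := fun h => (h.edgeSolvable_of_dualHalf ht).nodeSolvable_of_half ht
  tfae_finish
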